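/- Let $f_\pm:\mathbb R^n\times\mathbb R^m\times\mathbb R\to\mathbb R^n$, $g:\mathbb R^n\times\mathbb R^m\times\mathbb R\to\mathbb R^m$, $h:\mathbb R^n\times\mathbb R^m\times\mathbb R\to\mathbb R$ and $y_c:\mathbb R^n\to\mathbb R^m$, and consider for $\varepsilon>0$ the slow-fast Filippov system $$\dot x=\begin{cases}f_+(x,y,\varepsilon)&\text{if }h(x,y,\varepsilon)>0,\\ f_-(x,y,\varepsilon)&\text{if }h(x,y,\varepsilon)<0,\end{cases}\qquad \varepsilon\dot y=g(x,y,\varepsilon).\tag{1}$$ A trajectory of (1) on $[0,T]$ is an absolutely continuous curve $(x,y)$ satisfying (1) for almost every time, where on $\{h=0\}$ the velocity $\dot x$ may be any convex combination of $f_+$ and $f_-$ (Filippov's convention). It is non-sliding if $h(x(s),y(s),\varepsilon)$ vanishes identically on no time interval of positive length. Fix $x_0\in\mathbb R^n$ and let $f_\pm,g,h$ be $C^1$ near $(x_0,y_c(x_0),0)$. Subscripts $x,y$ denote partial derivatives; put $h_{\mathrm{rd},x}=h_x-h_yg_y^{-1}g_x$. A superscript $0$ denotes evaluation at $(x_0,y_c(x_0),0)$.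 Assume: 1. (Fast equilibrium, transversal stability) There is $c_{\mathrm{stab}}>0$ such that, for all $x$ near $x_0$, $g(x,y_c(x),0)=0$ and every complex eigenvalue of $g_y(x,y_c(x),0)$ has real part less than $-c_{\mathrm{stab}}$. 2. (Attracting sliding in the reduced system) $h_{\mathrm{rd},x}f_+<0<h_{\mathrm{rd},x}f_-$ at $(x,y_c(x),0)$ for all $x$ near $x_0$ with $h(x,y_c(x),0)=0$. 3. (Transversality) $h(x_0,y_c(x_0),0)=0$, and near $(x_0,y_c(x_0))$ the sets $\{h(\cdot,\cdot,0)=0\}$ and $\{g(\cdot,\cdot,0)=0\}$ intersect transversally, i.e. the derivative of $(x,y)\mapsto(h(x,y,0),g(x,y,0))$ is surjective on their intersection. 4. (Repelling sliding in the full system) $S_-<T_-<T_+<S_+$, where $T_\pm=h_x^0f_\pm^0$ and $S_\pm=h_y^0[g_y^0]^{-1}g_x^0f_\pm^0$. Let $f_{\mathrm{rd,s}}(x_0)=f_+^0+\alpha(f_-^0-f_+^0)$ with $\alpha=-\dfrac{h_{\mathrm{rd},x}^0f_+^0}{h_{\mathrm{rd},x}^0(f_-^0-f_+^0)}$ be the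 sliding vector field of the reduced system at $x_0$. Then for all $\rho_x,\rho_y>0$ there is $\rho_f>0$ such that for every $\rho_t>0$ there is $\varepsilon_{\max}>0$ with the following property. Whenever $|\delta_x|\le\rho_x$, $|\delta_y|\le\rho_y$ and $\varepsilon\in(0,\varepsilon_{\max})$, there is a non-sliding trajectory of (1) on $[0,\varepsilon\rho_t]$ starting from $(x_0+\varepsilon\delta_x,\;y_c(x_0)+\varepsilon\delta_y)$, and for every such trajectory $(x,y)$ there is a continuous function $r:\mathbb R\to\mathbb R^{n+m}$ with $|r(t)|\le\rho_f$ for all $t\in\mathbb R$ and $$\begin{bmatrix}x(\varepsilon t)\\y(\varepsilon t)\end{bmatrix}-\begin{bmatrix}x(0)\\y(0)\end{bmatrix}=\varepsilon t\begin{bmatrix}f_{\mathrm{rd,s}}(x_0)\\-[g_y^0]^{-1}g_x^0f_{\mathrm{rd,s}}(x_0)\end{bmatrix}+\varepsilon\,r(t)\qquad\text{for all }t\in[0,\rho_t].$$ In particular $\rho_f$ does not depend on $\rho_t$. -/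

import Mathlib

open Set Filter Topology MeasureTheory

noncomputable section

/-- Data of the slow-fast system with discontinuity
`x' = f₊(x,y,ε)` if `h(x,y,ε) > 0`, `x' = f₋(x,y,ε)` if `h(x,y,ε) < 0`, `ε y' = g(x,y,ε)`,
with `x ∈ ℝⁿ`, `y ∈ ℝᵐ`. -/
structure SlowFastSystem (n m : ℕ) where
  fPlus : EuclideanSpace ℝ (Fin n) × EuclideanSpace ℝ (Fin m) × ℝ → EuclideanSpace ℝ (Fin n)
  fMinus : EuclideanSpace ℝ (Fin n) × EuclideanSpace ℝ (Fin m) × ℝ → EuclideanSpace ℝ (Fin n)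
  g : EuclideanSpace ℝ (Fin n) × EuclideanSpace ℝ (Fin m) × ℝ → EuclideanSpace ℝ (Fin m)
  h : EuclideanSpace ℝ (Fin n) × EuclideanSpace ℝ (Fin m) × ℝ → ℝ

namespace SlowFastSystem

variable {n m : ℕ} (S : SlowFastSystem n m)

/-! ### Jacobians and derived quantities -/

/-- Continuous differentiability of all coefficients in a neighbourhood of `p`. -/
def SmoothNear (p : EuclideanSpace ℝ (Fin n) × EuclideanSpace ℝ (Fin m) × ℝ) : Prop :=
  ContDiffAt ℝ 1 S.fPlus p ∧ ContDiffAt ℝ 1 S.fMinus p ∧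
    ContDiffAt ℝ 1 S.g p ∧ ContDiffAt ℝ 1 S.h p

/-- The partial derivative `h_x` at `p`. -/
def hx (p : EuclideanSpace ℝ (Fin n) × EuclideanSpace ℝ (Fin m) × ℝ) :
    EuclideanSpace ℝ (Fin n) →L[ℝ] ℝ :=
  fderiv ℝ (fun x => S.h (x, p.2.1, p.2.2)) p.1

/-- The partial derivative `h_y` at `p`. -/
def hy (p : EuclideanSpace ℝ (Fin n) × EuclideanSpace ℝ (Fin m) × ℝ) :
    EuclideanSpace ℝ (Fin m) →L[ℝ] ℝ :=
  fderiv ℝ (fun y => S.h (p.1, y, p.2.2)) p.2.1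

/-- The partial derivative `g_x` at `p`. -/
def gx (p : EuclideanSpace ℝ (Fin n) × EuclideanSpace ℝ (Fin m) × ℝ) :
    EuclideanSpace ℝ (Fin n) →L[ℝ] EuclideanSpace ℝ (Fin m) :=
  fderiv ℝ (fun x => S.g (x, p.2.1, p.2.2)) p.1

/-- The partial derivative `g_y` at `p`. -/
def gy (p : EuclideanSpace ℝ (Fin n) × EuclideanSpace ℝ (Fin m) × ℝ) :
    EuclideanSpace ℝ (Fin m) →L[ℝ] EuclideanSpace ℝ (Fin m) :=
  fderiv ℝ (fun y => S.g (p.1, y, p.2.2)) p.2.1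

/-- The product `g_y⁻¹ g_x` at `p` (`g_y` is invertible wherever `0` is not in its spectrum). -/
def gyInvGx (p : EuclideanSpace ℝ (Fin n) × EuclideanSpace ℝ (Fin m) × ℝ) :
    EuclideanSpace ℝ (Fin n) →L[ℝ] EuclideanSpace ℝ (Fin m) :=
  (S.gy p).inverse.comp (S.gx p)

/-- `h_{rd,x} = h_x - h_y g_y⁻¹ g_x` at `p`. -/
def hrdx (p : EuclideanSpace ℝ (Fin n) × EuclideanSpace ℝ (Fin m) × ℝ) :
    EuclideanSpace ℝ (Fin n) →L[ℝ] ℝ :=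
  S.hx p - (S.hy p).comp (S.gyInvGx p)

/-- The complex spectrum of the real Jacobian matrix `g_y` at `p`. -/
def specGy (p : EuclideanSpace ℝ (Fin n) × EuclideanSpace ℝ (Fin m) × ℝ) : Set ℂ :=
  spectrum ℂ ((LinearMap.toMatrix (EuclideanSpace.basisFun (Fin m) ℝ).toBasis
    (EuclideanSpace.basisFun (Fin m) ℝ).toBasis (S.gy p).toLinearMap).map (algebraMap ℝ ℂ))

/-- `T₊ = h_x f₊`. -/
def TPlus (p : EuclideanSpace ℝ (Fin n) × EuclideanSpace ℝ (Fin m) × ℝ) : ℝ :=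
  S.hx p (S.fPlus p)

/-- `T₋ = h_x f₋`. -/
def TMinus (p : EuclideanSpace ℝ (Fin n) × EuclideanSpace ℝ (Fin m) × ℝ) : ℝ :=
  S.hx p (S.fMinus p)

/-- `S₊ = h_y g_y⁻¹ g_x f₊`. -/
def SPlus (p : EuclideanSpace ℝ (Fin n) × EuclideanSpace ℝ (Fin m) × ℝ) : ℝ :=
  S.hy p (S.gyInvGx p (S.fPlus p))

/-- `S₋ = h_y g_y⁻¹ g_x f₋`. -/
def SMinus (p : EuclideanSpace ℝ (Fin n) × EuclideanSpace ℝ (Fin m) × ℝ) : ℝ :=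
  S.hy p (S.gyInvGx p (S.fMinus p))

/-- `α_rd = - h_{rd,x} f₊ / (h_{rd,x} (f₋ - f₊))`. -/
def alphaRd (p : EuclideanSpace ℝ (Fin n) × EuclideanSpace ℝ (Fin m) × ℝ) : ℝ :=
  -(S.hrdx p (S.fPlus p) / S.hrdx p (S.fMinus p - S.fPlus p))

/-- The sliding vector field of the reduced system, `f_{rd,s} = f₊ + α_rd (f₋ - f₊)`. -/
def fRdS (p : EuclideanSpace ℝ (Fin n) × EuclideanSpace ℝ (Fin m) × ℝ) :
    EuclideanSpace ℝ (Fin n) :=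
  S.fPlus p + S.alphaRd p • (S.fMinus p - S.fPlus p)

/-! ### The standing assumptions, near a point `(x₀, y_c(x₀))` -/

/-- `y_c(x)` is an equilibrium of the fast subsystem at `ε = 0`, for all `x` near `x₀`. -/
def FastEquilibriumNear (yc : EuclideanSpace ℝ (Fin n) → EuclideanSpace ℝ (Fin m))
    (x₀ : EuclideanSpace ℝ (Fin n)) : Prop :=
  ∀ᶠ x in 𝓝 x₀, S.g (x, yc x, 0) = 0

/-- Transversal stability: `Re spec g_y(x, y_c(x), 0) < -c_stab < 0` for all `x` near `x₀`. -/
def TransversallyStableNear (yc : EuclideanSpace ℝ (Fin n) → EuclideanSpace ℝ (Fin m))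
    (x₀ : EuclideanSpace ℝ (Fin n)) : Prop :=
  ∃ cstab : ℝ, 0 < cstab ∧
    ∀ᶠ x in 𝓝 x₀, ∀ μ ∈ S.specGy (x, yc x, 0), μ.re < -cstab

/-- Attracting sliding in the reduced system: `h_{rd,x} f₊ < 0 < h_{rd,x} f₋` at the points
`x` near `x₀` of the switching manifold `h_rd(x) = h(x, y_c(x), 0) = 0`. -/
def AttractingReducedSlidingNear (yc : EuclideanSpace ℝ (Fin n) → EuclideanSpace ℝ (Fin m))
    (x₀ : EuclideanSpace ℝ (Fin n)) : Prop :=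
  ∀ᶠ x in 𝓝 x₀, S.h (x, yc x, 0) = 0 →
    S.hrdx (x, yc x, 0) (S.fPlus (x, yc x, 0)) < 0 ∧
      0 < S.hrdx (x, yc x, 0) (S.fMinus (x, yc x, 0))

/-- Transversality: near `(x₀, y_c(x₀))`, which lies in the switching manifold at `ε = 0`, the
switching manifold `h(·,·,0) = 0` and the slow manifold `g(·,·,0) = 0` intersect
transversally, i.e. `D(h, g)(·,·,0)` has full rank `m + 1` on their intersection. -/
def TransversalNear (yc : EuclideanSpace ℝ (Fin n) → EuclideanSpace ℝ (Fin m))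
    (x₀ : EuclideanSpace ℝ (Fin n)) : Prop :=
  S.h (x₀, yc x₀, 0) = 0 ∧
    ∀ᶠ z in 𝓝 (x₀, yc x₀), S.h (z.1, z.2, 0) = 0 → S.g (z.1, z.2, 0) = 0 →
      Function.Surjective
        (fderiv ℝ (fun w : EuclideanSpace ℝ (Fin n) × EuclideanSpace ℝ (Fin m) =>
          (S.h (w.1, w.2, 0), S.g (w.1, w.2, 0))) z)

/-! ### Trajectories -/

/-- The set of admissible slow velocities under the Filippov convention: `f₊` where `h > 0`,
`f₋` where `h < 0`, all convex combinations of `f₊` and `f₋` where `h = 0`. -/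
def filippovSet (p : EuclideanSpace ℝ (Fin n) × EuclideanSpace ℝ (Fin m) × ℝ) :
    Set (EuclideanSpace ℝ (Fin n)) :=
  {v | (0 < S.h p → v = S.fPlus p) ∧ (S.h p < 0 → v = S.fMinus p) ∧
    v ∈ segment ℝ (S.fMinus p) (S.fPlus p)}

/-- `(x, y)` is a trajectory on `[0, T]` in the sense of Filippov: absolutely continuous, and
satisfying the differential inclusion almost everywhere. -/
structure IsTrajectory (ε T : ℝ) (x : ℝ → EuclideanSpace ℝ (Fin n))
    (y : ℝ → EuclideanSpace ℝ (Fin m)) : Prop where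
  absCont_x : AbsolutelyContinuousOnInterval x 0 T
  absCont_y : AbsolutelyContinuousOnInterval y 0 T
  slow : ∀ᵐ s : ℝ, s ∈ Icc 0 T →
    ∃ v ∈ S.filippovSet (x s, y s, ε), HasDerivAt x v s
  fast : ∀ᵐ s : ℝ, s ∈ Icc 0 T →
    HasDerivAt y (ε⁻¹ • S.g (x s, y s, ε)) s

/-- The trajectory has no sliding segment: it does not stay in the switching manifold
during any time interval of positive length. -/
def NonSliding (ε T : ℝ) (x : ℝ → EuclideanSpace ℝ (Fin n))
    (y : ℝ → EuclideanSpace ℝ (Fin m)) : Prop :=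
  ∀ a b : ℝ, 0 ≤ a → a < b → b ≤ T → ∃ s ∈ Icc a b, S.h (x s, y s, ε) ≠ 0

/-- A non-sliding trajectory on `[0, T]` starting from `(ξ, η)`. -/
structure IsNonSlidingTrajectoryFrom (ε T : ℝ) (ξ : EuclideanSpace ℝ (Fin n))
    (η : EuclideanSpace ℝ (Fin m)) (x : ℝ → EuclideanSpace ℝ (Fin n))
    (y : ℝ → EuclideanSpace ℝ (Fin m)) : Prop where
  trajectory : S.IsTrajectory ε T x y
  nonSliding : S.NonSliding ε T x y
  init_x : x 0 = ξ
  init_y : y 0 = η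

end SlowFastSystem

end

/-! Everything happens in the blown-up coordinates `ξ = (x - x₀)/ε`, `η = (y - y₀)/ε`. With `A =
g_y`, `J = g_y⁻¹ g_x`, `q = g_ε` at the base point, the deviation `Z = η + Jξ + A⁻¹q` from the
linearised slow manifold satisfies `ε Z' = A Z + bounded`. A quadratic Lyapunov function for `A`
therefore bounds `Z` independently of the time span (`exists_lyapunov`, `blowup_bounds`).

Consequently `h/ε` differs from `ℓ ξ`, with `ℓ = h_{rd,x}`, by a bounded amount. If `ℓ ξ` is large
and positive, then `h > 0`, so the velocity is near `f₊` and `ℓ ξ` decreases; the other sign is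
symmetric. Thus `ℓ ξ` stays bounded. The projection along `f₋ - f₊` onto `ker ℓ` sends both `f₊` and
`f₋`, hence every convex combination, to `f_{rd,s}`, so the projected curve follows `f_{rd,s}` up to
an error that small `ε` makes at most one. Together these control `ξ`, and `Z` then controls `η`
(`eventually_trajectory_bounds`). The argument covers every Filippov trajectory, sliding or not.

Existence rests on `T₋ < T₊`. Along the full fields the derivatives of `h` differ by `h_x(f₊ - f₋)`,
because the large fast contribution is common to both. At each switching point at least one field
thus leaves strictly into its own region, and following it produces a non-sliding continuation for a
uniform time (`exists_switchedCurve_local`). The bounds above keep the curve where this applies, so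
finitely many pieces reach the final time. -/

open scoped InnerProductSpace
open Metric (closedBall mem_closedBall)

/-! ### Differential inequalities for absolutely continuous functions -/

namespace AbsolutelyContinuousOnInterval

/-- Composition with a function that is Lipschitz on a set containing the values. -/
theorem comp_lipschitzOnWith {X Y : Type*} [PseudoMetricSpace X] [PseudoMetricSpace Y]
    {f : ℝ → X} {a b : ℝ} (hf : AbsolutelyContinuousOnInterval f a b) {ψ : X → Y} {K : NNReal}
    {s : Set X} (hψ : LipschitzOnWith K ψ s) (hs : MapsTo f (uIcc a b) s) :
    AbsolutelyContinuousOnInterval (fun t => ψ (f t)) a b := by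
  have hK : Tendsto (fun E : ℕ × (ℕ → ℝ × ℝ) =>
      (K : ℝ) * ∑ i ∈ Finset.range E.1, dist (f (E.2 i).1) (f (E.2 i).2))
      (totalLengthFilter ⊓ 𝓟 (disjWithin a b)) (𝓝 0) := by
    simpa using Tendsto.const_mul (K : ℝ) hf
  refine squeeze_zero' (Eventually.of_forall fun _ => Finset.sum_nonneg fun _ _ => dist_nonneg)
    ?_ hK
  rw [eventually_inf_principal]
  filter_upwards with E hE
  rw [Finset.mul_sum]
  refine Finset.sum_le_sum fun i hi => ?_
  exact hψ.dist_le_mul _ (hs (hE.1 i hi).1) _ (hs (hE.1 i hi).2)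

/-- Composition with a `C¹` function. -/
theorem comp_contDiff {E F : Type*} [NormedAddCommGroup E] [NormedSpace ℝ E] [ProperSpace E]
    [NormedAddCommGroup F] [NormedSpace ℝ F] {f : ℝ → E} {a b : ℝ}
    (hf : AbsolutelyContinuousOnInterval f a b) {ψ : E → F} (hψ : ContDiff ℝ 1 ψ) :
    AbsolutelyContinuousOnInterval (fun t => ψ (f t)) a b := by
  obtain ⟨C, hC⟩ := hf.exists_bound
  obtain ⟨K, hK⟩ := (hψ.contDiffOn (s := Metric.closedBall (0 : E) C)).exists_lipschitzOnWith
    (by decide) (convex_closedBall _ _) (isCompact_closedBall _ _)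
  exact hf.comp_lipschitzOnWith hK fun t ht => by simpa using hC t ht

/-- An absolutely continuous function with almost everywhere nonpositive derivative does not
increase. -/
theorem le_of_ae_hasDerivAt_nonpos {φ : ℝ → ℝ} {a b : ℝ}
    (hφ : AbsolutelyContinuousOnInterval φ a b) (hab : a ≤ b)
    (hd : ∀ᵐ s : ℝ, s ∈ Icc a b → ∃ d ≤ 0, HasDerivAt φ d s) : φ b ≤ φ a := by
  have h := hφ.integral_deriv_eq_sub
  have h2 : ∫ s in a..b, deriv φ s ≤ ∫ s in a..b, (0 : ℝ) := by
    refine intervalIntegral.integral_mono_ae_restrict hab hφ.intervalIntegrable_deriv (by simp) ?_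
    filter_upwards [ae_restrict_of_ae hd, ae_restrict_mem measurableSet_Icc] with s hs hs'
    obtain ⟨d, hd0, hds⟩ := hs hs'
    simpa [hds.deriv] using hd0
  simp only [intervalIntegral.integral_zero] at h2
  linarith

/-- Barrier principle: an absolutely continuous function which cannot increase above the level
`K` stays below `K`. -/
theorem le_of_barrier {φ : ℝ → ℝ} {T K : ℝ}
    (hφ : AbsolutelyContinuousOnInterval φ 0 T) (h0 : φ 0 ≤ K)
    (hd : ∀ᵐ s : ℝ, s ∈ Icc 0 T → K < φ s → ∃ d ≤ 0, HasDerivAt φ d s) :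
    ∀ t ∈ Icc 0 T, φ t ≤ K := by
  intro t ht
  by_contra! hlt
  have hc : ContinuousOn φ (Icc 0 t) :=
    hφ.continuousOn.mono (by rw [uIcc_of_le (ht.1.trans ht.2)]; exact Icc_subset_Icc_right ht.2)
  set A := {s ∈ Icc 0 t | φ s ≤ K} with hA
  have hAc : IsCompact A :=
    isCompact_Icc.of_isClosed_subset (hc.preimage_isClosed_of_isClosed isClosed_Icc isClosed_Iic)
      fun s hs => hs.1
  -- The last time before `t` at which the level is respected. After it the derivative is
  -- nonpositive almost everywhere; `c` itself, where nothing is known about the derivative, is a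
  -- null set.
  obtain ⟨c, hcA, hcmax⟩ := hAc.exists_isGreatest ⟨0, ⟨le_rfl, ht.1⟩, h0⟩
  have hmono : AbsolutelyContinuousOnInterval φ c t := hφ.mono (by
    rw [uIcc_of_le hcA.1.2, uIcc_of_le (ht.1.trans ht.2)]
    exact Icc_subset_Icc hcA.1.1 ht.2)
  have := hmono.le_of_ae_hasDerivAt_nonpos hcA.1.2 (by
    filter_upwards [hd, measure_eq_zero_iff_ae_notMem.mp (measure_singleton c)] with s hs hsc hst
    refine hs ⟨hcA.1.1.trans hst.1, hst.2.trans ht.2⟩ ?_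
    by_contra! hle
    have : s ≤ c := hcmax ⟨⟨hcA.1.1.trans hst.1, hst.2⟩, hle⟩
    exact hsc (le_antisymm this hst.1))
  linarith [hcA.2]

/-- Mean value inequality for absolutely continuous functions. -/
theorem norm_sub_le_of_ae_hasDerivAt {F : Type*} [NormedAddCommGroup F] [NormedSpace ℝ F]
    [ProperSpace F] {f : ℝ → F} {a b C : ℝ} (hf : AbsolutelyContinuousOnInterval f a b)
    (hab : a ≤ b) (hd : ∀ᵐ s : ℝ, s ∈ Icc a b → ∃ v, ‖v‖ ≤ C ∧ HasDerivAt f v s) :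
    ‖f b - f a‖ ≤ C * (b - a) := by
  -- A norming functional reduces the claim to monotonicity of the scalar function `g ∘ f - C t`.
  obtain ⟨g, hg1, hg⟩ := exists_dual_vector'' ℝ (f b - f a)
  have hac : AbsolutelyContinuousOnInterval (fun t => g (f t) - C * t) a b :=
    (hf.comp_contDiff g.contDiff).fun_sub
      ((contDiff_const.mul contDiff_id).contDiffOn.absolutelyContinuousOnInterval)
  have := hac.le_of_ae_hasDerivAt_nonpos hab (by
    filter_upwards [hd] with s hs hst
    obtain ⟨v, hv, hvs⟩ := hs hst
    refine ⟨g v - C, ?_, ?_⟩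
    · have : g v ≤ ‖g‖ * ‖v‖ := (le_abs_self _).trans (g.le_opNorm v)
      have : ‖g‖ * ‖v‖ ≤ 1 * ‖v‖ := by gcongr
      linarith
    · have h1 := g.hasFDerivAt.comp_hasDerivAt s hvs
      have h2 : HasDerivAt (fun t : ℝ => C * t) C s := by
        simpa using (hasDerivAt_id s).const_mul C
      exact h1.sub h2)
  rw [map_sub] at hg
  simp only [RCLike.ofReal_real_eq_id, id_eq] at hg
  rw [← hg]
  linarith

end AbsolutelyContinuousOnInterval

/-! ### First hitting times and continuous induction -/

/-- A continuous function on `[0, T]` that starts below `R` and reaches `R` has a first time at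
which it does. -/
theorem exists_first_hit {ψ : ℝ → ℝ} {T R s : ℝ} (hψ : ContinuousOn ψ (Icc 0 T)) (h0 : ψ 0 < R)
    (hs : s ∈ Icc 0 T) (hsR : R ≤ ψ s) :
    ∃ c, 0 < c ∧ c ≤ s ∧ ψ c = R ∧ ∀ t ∈ Ico 0 c, ψ t < R := by
  set A := {t ∈ Icc 0 T | R ≤ ψ t} with hA
  have hAc : IsCompact A :=
    isCompact_Icc.of_isClosed_subset (hψ.preimage_isClosed_of_isClosed isClosed_Icc isClosed_Ici)
      fun s hs => hs.1
  obtain ⟨c, hcA, hcmin⟩ := hAc.exists_isLeast ⟨s, hs, hsR⟩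
  have hbelow : ∀ t ∈ Ico 0 c, ψ t < R := fun t ht => by
    by_contra! h
    exact absurd (hcmin ⟨⟨ht.1, ht.2.le.trans hcA.1.2⟩, h⟩) (not_le.mpr ht.2)
  have hc0 : 0 < c := lt_of_le_of_ne hcA.1.1 fun h => by
    have := hcA.2
    rw [← h] at this
    linarith
  have hcR : ψ c ≤ R := by
    have h1 : Tendsto ψ (𝓝[Ico 0 c] c) (𝓝 (ψ c)) :=
      (hψ c hcA.1).mono fun t ht => ⟨ht.1, ht.2.le.trans hcA.1.2⟩
    have : (𝓝[Ico 0 c] c).NeBot := by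
      rw [← mem_closure_iff_nhdsWithin_neBot, closure_Ico hc0.ne]
      exact ⟨hc0.le, le_rfl⟩
    exact le_of_tendsto h1 (eventually_nhdsWithin_of_forall fun t ht => (hbelow t ht).le)
  exact ⟨c, hc0, hcmin ⟨hs, hsR⟩, le_antisymm hcR hcA.2, hbelow⟩

/-- Continuous induction: a continuous function that starts below `R`, and is below `R` at the end
of every initial interval on which it is at most `R`, stays below `R`. -/
theorem lt_of_bootstrap {ψ : ℝ → ℝ} {T R : ℝ} (hψ : ContinuousOn ψ (Icc 0 T)) (h0 : ψ 0 < R)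
    (hstep : ∀ s ∈ Icc 0 T, (∀ t ∈ Icc 0 s, ψ t ≤ R) → ψ s < R) :
    ∀ s ∈ Icc 0 T, ψ s < R := by
  intro s hs
  by_contra! hlt
  obtain ⟨c, hc0, hcs, hcR, hbelow⟩ := exists_first_hit hψ h0 hs hlt
  refine absurd (hstep c ⟨hc0.le, hcs.trans hs.2⟩ fun t ht => ?_) (not_lt.mpr hcR.ge)
  rcases ht.2.eq_or_lt with h | h
  · rw [h, hcR]
  · exact (hbelow t ⟨ht.1, h⟩).le

/-! ### Spectral stability and Lyapunov functions -/

section MatrixPower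

attribute [local instance] Matrix.linftyOpNormedRing Matrix.linftyOpNormedAlgebra
  Matrix.linftyOpNormedAddCommGroup Matrix.linftyOpNormedSpace

/-- Powers of an element of spectral radius less than one tend to zero. -/
theorem tendsto_pow_nhds_zero_of_spectralRadius_lt_one {A : Type*} [NormedRing A]
    [NormedAlgebra ℂ A] [CompleteSpace A] (a : A) (ha : spectralRadius ℂ a < 1) :
    Tendsto (fun k : ℕ => a ^ k) atTop (𝓝 0) := by
  obtain ⟨q, hq1, hq2⟩ := ENNReal.lt_iff_exists_nnreal_btwn.mp ha
  have hq2' : q < 1 := by exact_mod_cast hq2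
  -- Gelfand's formula: eventually `‖a ^ k‖ ≤ q ^ k` with `q < 1`.
  have h := (spectrum.pow_nnnorm_pow_one_div_tendsto_nhds_spectralRadius a).eventually_lt_const hq1
  rw [tendsto_zero_iff_norm_tendsto_zero]
  refine squeeze_zero' (Eventually.of_forall fun _ => norm_nonneg _) ?_
    (tendsto_pow_atTop_nhds_zero_of_lt_one q.2 (by exact_mod_cast hq2'))
  filter_upwards [h, eventually_gt_atTop 0] with k hk hk0
  have h1 : (‖a ^ k‖₊ : ENNReal) ≤ (q : ENNReal) ^ k := by
    have := ENNReal.rpow_le_rpow hk.le (z := (k : ℝ)) (by positivity)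
    rwa [← ENNReal.rpow_mul, one_div, inv_mul_cancel₀ (by positivity), ENNReal.rpow_one,
      ENNReal.rpow_natCast] at this
  exact_mod_cast h1

/-- If the spectrum of a complex matrix lies in a half plane `Re μ < -c`, some explicit Euler step
matrix `1 + h A` has powers tending to zero. -/
theorem Matrix.exists_tendsto_one_add_smul_pow {m : ℕ} (A : Matrix (Fin m) (Fin m) ℂ) {c : ℝ}
    (hc : 0 < c) (hA : ∀ μ ∈ spectrum ℂ A, μ.re < -c) :
    ∃ h : ℝ, 0 < h ∧ Tendsto (fun k : ℕ => (1 + (h : ℂ) • A) ^ k) atTop (𝓝 0) := by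
  set N : ℝ := ‖A‖ * ‖(1 : Matrix (Fin m) (Fin m) ℂ)‖ + c + 1 with hN
  have hN0 : 0 < N := by positivity
  -- `N` bounds the moduli of the spectrum, so `|1 + hμ|² ≤ 1 - 2hc + h²N²`; this step size makes
  -- the right side `1 - hc`.
  set h : ℝ := c / N ^ 2 with hh
  have hh0 : 0 < h := by positivity
  have hhN : h * N ^ 2 = c := by rw [hh]; field_simp
  refine ⟨h, hh0, tendsto_pow_nhds_zero_of_spectralRadius_lt_one _ ?_⟩
  set q : NNReal := ⟨Real.sqrt (1 - h * c), Real.sqrt_nonneg _⟩ with hq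
  have hq1 : q < 1 := by
    rw [← NNReal.coe_lt_coe, hq]
    change Real.sqrt (1 - h * c) < 1
    rw [Real.sqrt_lt' one_pos]
    nlinarith [mul_pos hh0 hc]
  refine lt_of_le_of_lt (b := (q : ENNReal)) ?_ (by exact_mod_cast hq1)
  refine iSup₂_le fun ν hν => ?_
  have hne : (h : ℂ) ≠ 0 := by exact_mod_cast hh0.ne'
  have hmem : (ν - 1) / h ∈ spectrum ℂ A := by
    rw [spectrum.mem_iff] at hν ⊢
    refine fun hu => hν ?_
    have : algebraMap ℂ (Matrix (Fin m) (Fin m) ℂ) ν - (1 + (h : ℂ) • A) =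
        (Units.mk0 (h : ℂ) hne) • (algebraMap ℂ _ ((ν - 1) / h) - A) := by
      rw [Units.smul_mk0, smul_sub, Algebra.algebraMap_eq_smul_one, Algebra.algebraMap_eq_smul_one,
        smul_smul, mul_div_cancel₀ _ hne, sub_smul, one_smul]
      abel
    rw [this]
    exact hu.smul _
  set μ := (ν - 1) / h with hμ
  have hνμ : ν = 1 + h * μ := by rw [hμ]; field_simp; ring
  have h1 := hA μ hmem
  have h2 : ‖μ‖ ≤ N := by
    have := spectrum.norm_le_norm_mul_of_mem hmem
    linarith
  have h3 : ‖ν‖ ^ 2 ≤ 1 - h * c := by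
    have e1 : ‖ν‖ ^ 2 = 1 + 2 * h * μ.re + h ^ 2 * ‖μ‖ ^ 2 := by
      rw [hνμ, Complex.sq_norm, Complex.sq_norm, Complex.normSq_apply, Complex.normSq_apply]
      simp
      ring
    have e2 : ‖μ‖ ^ 2 ≤ N ^ 2 := by gcongr
    have e3 : h ^ 2 * ‖μ‖ ^ 2 ≤ h * c := by
      calc h ^ 2 * ‖μ‖ ^ 2 ≤ h ^ 2 * N ^ 2 := by gcongr
        _ = h * c := by rw [← hhN]; ring
    nlinarith
  have h4 : ‖ν‖ ≤ q := by
    rw [hq]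
    exact Real.le_sqrt_of_sq_le h3
  exact_mod_cast h4

end MatrixPower

/-- The continuous linear endomorphisms of `ℝᵐ` whose complex spectrum lies in `Re μ < -c` have
an explicit Euler step with arbitrarily contracting powers. -/
theorem exists_norm_one_add_smul_pow_lt {m : ℕ}
    (A : EuclideanSpace ℝ (Fin m) →L[ℝ] EuclideanSpace ℝ (Fin m)) {c : ℝ} (hc : 0 < c)
    (hA : ∀ μ ∈ spectrum ℂ ((LinearMap.toMatrix (EuclideanSpace.basisFun (Fin m) ℝ).toBasis
      (EuclideanSpace.basisFun (Fin m) ℝ).toBasis A.toLinearMap).map (algebraMap ℝ ℂ)),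
      μ.re < -c) :
    ∃ h : ℝ, 0 < h ∧ ∃ k : ℕ, 0 < k ∧ ‖(1 + h • A) ^ k‖ < 1 / 2 := by
  obtain ⟨h, hh, hlim⟩ := Matrix.exists_tendsto_one_add_smul_pow _ hc hA
  refine ⟨h, hh, ?_⟩
  set b := (EuclideanSpace.basisFun (Fin m) ℝ).toBasis with hb
  set M := LinearMap.toMatrix b b A.toLinearMap with hM
  -- The complex powers are complexifications of the real ones, so taking entrywise real parts
  -- transfers the limit to the real matrix.
  have hre : Tendsto (fun k : ℕ => (1 + h • M) ^ k) atTop (𝓝 0) := by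
    have h1 : Continuous fun Q : Matrix (Fin m) (Fin m) ℂ => Q.map Complex.re :=
      continuous_id.matrix_map Complex.continuous_re
    have h2 := (h1.tendsto 0).comp hlim
    have h3 : (0 : Matrix (Fin m) (Fin m) ℂ).map Complex.re = 0 := by ext; simp
    rw [h3] at h2
    refine h2.congr fun k => ?_
    have h4 : (1 + (h : ℂ) • M.map (algebraMap ℝ ℂ)) ^ k =
        ((1 + h • M) ^ k).map (algebraMap ℝ ℂ) := by
      have : (1 + (h : ℂ) • M.map (algebraMap ℝ ℂ)) = (algebraMap ℝ ℂ).mapMatrix (1 + h • M) := by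
        rw [map_add, map_one]
        congr 1
        ext i j
        simp
      rw [this, ← map_pow]
      rfl
    simp only [Function.comp_apply]
    rw [h4]
    ext i j
    simp
  let Ψ : Matrix (Fin m) (Fin m) ℝ →ₗ[ℝ] (EuclideanSpace ℝ (Fin m) →L[ℝ] EuclideanSpace ℝ (Fin m)) :=
    LinearMap.toContinuousLinearMap.toLinearMap ∘ₗ (Matrix.toLin b b).toLinearMap
  have hΨ : Continuous Ψ := LinearMap.continuous_of_finiteDimensional Ψ
  have h5 := (hΨ.tendsto 0).comp hre
  rw [map_zero] at h5
  have h6 : ∀ k : ℕ, Ψ ((1 + h • M) ^ k) = (1 + h • A) ^ k := by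
    intro k
    apply ContinuousLinearMap.coe_injective
    have e1 : (Ψ ((1 + h • M) ^ k) : EuclideanSpace ℝ (Fin m) →ₗ[ℝ] EuclideanSpace ℝ (Fin m)) =
        Matrix.toLin b b ((1 + h • M) ^ k) := rfl
    have e2 : Matrix.toLin b b ((1 + h • M) ^ k) = (Matrix.toLinAlgEquiv b (1 + h • M)) ^ k := by
      rw [← map_pow]; rfl
    have e3 : Matrix.toLinAlgEquiv b (1 + h • M) =
        ((1 + h • A : EuclideanSpace ℝ (Fin m) →L[ℝ] EuclideanSpace ℝ (Fin m)) :
          EuclideanSpace ℝ (Fin m) →ₗ[ℝ] EuclideanSpace ℝ (Fin m)) := by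
      rw [map_add, map_one, map_smul]
      have : Matrix.toLinAlgEquiv b M = A.toLinearMap := Matrix.toLin_toMatrix b b _
      rw [this]
      rfl
    rw [e1, e2, e3]
    clear e1 e2
    induction k with
    | zero => rfl
    | succ k ih => rw [pow_succ, pow_succ, ih]; rfl
  have h7 := (tendsto_zero_iff_norm_tendsto_zero.mp h5).eventually_lt_const
    (show (0 : ℝ) < 1 / 2 by norm_num)
  obtain ⟨k, hk, hk0⟩ := (h7.and (eventually_gt_atTop 0)).exists
  refine ⟨k, hk0, ?_⟩
  simpa [h6] using hk

/-- Lyapunov's theorem: a linear vector field all of whose eigenvalues have negative real part has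
a quadratic Lyapunov function. -/
theorem exists_lyapunov {m : ℕ}
    (A : EuclideanSpace ℝ (Fin m) →L[ℝ] EuclideanSpace ℝ (Fin m)) {c : ℝ} (hc : 0 < c)
    (hA : ∀ μ ∈ spectrum ℂ ((LinearMap.toMatrix (EuclideanSpace.basisFun (Fin m) ℝ).toBasis
      (EuclideanSpace.basisFun (Fin m) ℝ).toBasis A.toLinearMap).map (algebraMap ℝ ℂ)),
      μ.re < -c) :
    ∃ P : EuclideanSpace ℝ (Fin m) →L[ℝ] EuclideanSpace ℝ (Fin m), ∃ κ : ℝ, 0 < κ ∧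
      (∀ z w, ⟪P z, w⟫_ℝ = ⟪z, P w⟫_ℝ) ∧ (∀ z, ‖z‖ ^ 2 ≤ ⟪P z, z⟫_ℝ) ∧
      ∀ z, ⟪P z, A z⟫_ℝ ≤ -κ * ‖z‖ ^ 2 := by
  obtain ⟨h, hh, k, hk0, hk⟩ := exists_norm_one_add_smul_pow_lt A hc hA
  set B := 1 + h • A with hB
  -- A discrete replacement for `∫ exp(tA)* exp(tA) dt`. Under `z ↦ B z` the form telescopes to `‖B
  -- ^ k z‖² - ‖z‖² ≤ -‖z‖²/2`. Expanding `B = 1 + hA` and dropping the nonnegative `h²` term gives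
  -- `κ = 1/(4h)`; the summand `i = 0` gives the lower bound `‖z‖²`.
  let P := ∑ i ∈ Finset.range k, (ContinuousLinearMap.adjoint (B ^ i)).comp (B ^ i)
  have hP : ∀ z w, ⟪P z, w⟫_ℝ = ∑ i ∈ Finset.range k, ⟪(B ^ i) z, (B ^ i) w⟫_ℝ := by
    intro z w
    simp only [P, sum_apply, sum_inner, ContinuousLinearMap.comp_apply,
      ContinuousLinearMap.adjoint_inner_left]
  have hPsymm : ∀ z w, ⟪P z, w⟫_ℝ = ⟪z, P w⟫_ℝ := by
    intro z w
    rw [real_inner_comm (P w) z, hP, hP]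
    exact Finset.sum_congr rfl fun i _ => real_inner_comm _ _
  have hPpos : ∀ z, 0 ≤ ⟪P z, z⟫_ℝ := fun z => by
    rw [hP]
    exact Finset.sum_nonneg fun i _ => real_inner_self_nonneg
  refine ⟨P, 1 / (4 * h), by positivity, hPsymm, fun z => ?_, fun z => ?_⟩
  · rw [hP]
    refine le_trans ?_ (Finset.single_le_sum (fun i _ => real_inner_self_nonneg)
      (Finset.mem_range.mpr hk0))
    simp
  · have h1 : ⟪P (B z), B z⟫_ℝ - ⟪P z, z⟫_ℝ = ‖(B ^ k) z‖ ^ 2 - ‖z‖ ^ 2 := by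
      rw [hP, hP, ← Finset.sum_sub_distrib]
      have := Finset.sum_range_sub (fun i => ‖(B ^ i) z‖ ^ 2) k
      simp only [pow_zero, one_apply_eq_self] at this
      rw [← this]
      refine Finset.sum_congr rfl fun i _ => ?_
      rw [real_inner_self_eq_norm_sq, real_inner_self_eq_norm_sq, pow_succ]
      rfl
    have h2 : ⟪P (B z), B z⟫_ℝ =
        ⟪P z, z⟫_ℝ + 2 * h * ⟪P z, A z⟫_ℝ + h ^ 2 * ⟪P (A z), A z⟫_ℝ := by
      have e : B z = z + h • A z := by simp [hB]
      have e' : ⟪P (A z), z⟫_ℝ = ⟪P z, A z⟫_ℝ := by rw [hPsymm, real_inner_comm]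
      rw [e, map_add, map_smul, inner_add_left, inner_add_right, inner_add_right,
        real_inner_smul_left, real_inner_smul_left, real_inner_smul_right, real_inner_smul_right,
        e']
      ring
    have h3 : ‖(B ^ k) z‖ ^ 2 ≤ 1 / 2 * ‖z‖ ^ 2 := by
      have : ‖(B ^ k) z‖ ≤ 1 / 2 * ‖z‖ :=
        ((B ^ k).le_opNorm z).trans (by gcongr)
      nlinarith [norm_nonneg ((B ^ k) z), norm_nonneg z]
    have h4 : 2 * h * ⟪P z, A z⟫_ℝ ≤ -(1 / 2) * ‖z‖ ^ 2 := by
      nlinarith [mul_nonneg (sq_nonneg h) (hPpos (A z))]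
    have h5 : -(1 / (4 * h)) * ‖z‖ ^ 2 = (-(1 / 2) * ‖z‖ ^ 2) / (2 * h) := by
      field_simp
      ring
    rw [h5, le_div_iff₀ (by positivity)]
    linarith

/-! ### Construction of non-sliding curves for a pair of vector fields -/

section SwitchedFlow

variable {E : Type*} [NormedAddCommGroup E] [NormedSpace ℝ E]

/-- A curve on `[0, σ]` that almost everywhere is off the switching manifold `{H = 0}` and follows
`Fp` where `H > 0` and `Fm` where `H < 0`. -/
structure IsSwitchedCurve (Fp Fm : E → E) (H : E → ℝ) (C : NNReal) (σ : ℝ) (φ : ℝ → E) :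
    Prop where
  lipschitz : LipschitzOnWith C φ (Icc 0 σ)
  ae_deriv : ∀ᵐ s : ℝ, s ∈ Icc 0 σ → (0 < H (φ s) ∧ HasDerivAt φ (Fp (φ s)) s) ∨
    (H (φ s) < 0 ∧ HasDerivAt φ (Fm (φ s)) s)

namespace IsSwitchedCurve

variable {Fp Fm : E → E} {H : E → ℝ} {C : NNReal} {σ σ' : ℝ} {φ ψ : ℝ → E}

theorem mono (hφ : IsSwitchedCurve Fp Fm H C σ φ) (h : σ' ≤ σ) :
    IsSwitchedCurve Fp Fm H C σ' φ where
  lipschitz := hφ.lipschitz.mono (Icc_subset_Icc_right h)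
  ae_deriv := by
    filter_upwards [hφ.ae_deriv] with s hs hs'
    exact hs ⟨hs'.1, hs'.2.trans h⟩

/-- Exchanging the roles of the two sides. -/
theorem swap (hφ : IsSwitchedCurve Fp Fm H C σ φ) :
    IsSwitchedCurve Fm Fp (fun p => -H p) C σ φ where
  lipschitz := hφ.lipschitz
  ae_deriv := by
    filter_upwards [hφ.ae_deriv] with s hs hs'
    rcases hs hs' with h | h
    · exact Or.inr ⟨by simpa using h.1, h.2⟩
    · exact Or.inl ⟨by simpa using h.1, h.2⟩

/-- Concatenation. -/
theorem concat (hφ : IsSwitchedCurve Fp Fm H C σ φ) (hψ : IsSwitchedCurve Fp Fm H C σ' ψ)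
    (hσ : 0 ≤ σ) (hσ' : 0 ≤ σ') (hφψ : ψ 0 = φ σ) :
    ∃ χ, χ 0 = φ 0 ∧ IsSwitchedCurve Fp Fm H C (σ + σ') χ := by
  let χ : ℝ → E := fun t => if t ≤ σ then φ t else ψ (t - σ)
  have hχ1 : ∀ t ≤ σ, χ t = φ t := fun t ht => if_pos ht
  have hχ2 : ∀ t, σ ≤ t → χ t = ψ (t - σ) := fun t ht => by
    rcases ht.eq_or_lt with h | h
    · rw [hχ1 t h.ge, ← h, sub_self, hφψ]
    · exact if_neg h.not_ge
  have hl1 : ∀ s ∈ Icc 0 σ, ∀ t ∈ Icc 0 σ, dist (χ s) (χ t) ≤ C * dist s t := fun s hs t ht => by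
    rw [hχ1 s hs.2, hχ1 t ht.2]
    exact hφ.lipschitz.dist_le_mul s hs t ht
  have hl2 : ∀ s ∈ Icc σ (σ + σ'), ∀ t ∈ Icc σ (σ + σ'), dist (χ s) (χ t) ≤ C * dist s t :=
    fun s hs t ht => by
      rw [hχ2 s hs.1, hχ2 t ht.1]
      have := hψ.lipschitz.dist_le_mul (s - σ) ⟨by linarith [hs.1], by linarith [hs.2]⟩ (t - σ)
        ⟨by linarith [ht.1], by linarith [ht.2]⟩
      rwa [dist_sub_right] at this
  have hl3 : ∀ s ∈ Icc 0 σ, ∀ t ∈ Icc σ (σ + σ'), dist (χ s) (χ t) ≤ C * dist s t :=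
    fun s hs t ht => by
      have h1 := hl1 s hs σ ⟨hσ, le_rfl⟩
      have h2 := hl2 σ ⟨le_rfl, by linarith⟩ t ht
      have h3 : dist s t = dist s σ + dist σ t := by
        rw [Real.dist_eq, Real.dist_eq, Real.dist_eq, abs_of_nonpos (by linarith [hs.2, ht.1]),
          abs_of_nonpos (by linarith [hs.2]), abs_of_nonpos (by linarith [ht.1])]
        ring
      rw [h3, mul_add]
      exact (dist_triangle _ _ _).trans (add_le_add h1 h2)
  refine ⟨χ, hχ1 0 hσ, ?_, ?_⟩
  · refine LipschitzOnWith.of_dist_le_mul fun s hs t ht => ?_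
    rcases le_total s σ with h1 | h1 <;> rcases le_total t σ with h2 | h2
    · exact hl1 s ⟨hs.1, h1⟩ t ⟨ht.1, h2⟩
    · exact hl3 s ⟨hs.1, h1⟩ t ⟨h2, ht.2⟩
    · rw [dist_comm, dist_comm s t]
      exact hl3 t ⟨ht.1, h2⟩ s ⟨h1, hs.2⟩
    · exact hl2 s ⟨h1, hs.2⟩ t ⟨h2, ht.2⟩
  · have hshift := (measurePreserving_sub_right volume σ).quasiMeasurePreserving.ae hψ.ae_deriv
    filter_upwards [hφ.ae_deriv, hshift,
      measure_eq_zero_iff_ae_notMem.mp (measure_singleton (μ := volume) σ)] with s h1 h2 h3 hs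
    rcases lt_or_gt_of_ne (show s ≠ σ from h3) with h | h
    · have he : χ =ᶠ[𝓝 s] φ := by
        filter_upwards [Iio_mem_nhds h] with t ht
        exact hχ1 t (le_of_lt ht)
      rw [hχ1 s h.le]
      exact (h1 ⟨hs.1, h.le⟩).imp (fun k => ⟨k.1, k.2.congr_of_eventuallyEq he⟩)
        fun k => ⟨k.1, k.2.congr_of_eventuallyEq he⟩
    · have he : χ =ᶠ[𝓝 s] fun t => ψ (t - σ) := by
        filter_upwards [Ioi_mem_nhds h] with t ht
        exact hχ2 t (le_of_lt ht)
      rw [hχ2 s h.le]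
      exact (h2 ⟨by linarith, by linarith [hs.2]⟩).imp
        (fun k => ⟨k.1, (k.2.comp_sub_const s σ).congr_of_eventuallyEq he⟩)
        fun k => ⟨k.1, (k.2.comp_sub_const s σ).congr_of_eventuallyEq he⟩

/-- A flow line of `Fp` inside `{H > 0}` is a switched curve. -/
theorem of_pos {τ : ℝ} (hl : LipschitzOnWith C φ (Icc 0 τ))
    (hd : ∀ t ∈ Ioo 0 τ, HasDerivAt φ (Fp (φ t)) t) (hH : ∀ t ∈ Ioo 0 τ, 0 < H (φ t)) :
    IsSwitchedCurve Fp Fm H C τ φ where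
  lipschitz := hl
  ae_deriv := by
    filter_upwards [measure_eq_zero_iff_ae_notMem.mp (measure_singleton (μ := volume) (0 : ℝ)),
      measure_eq_zero_iff_ae_notMem.mp (measure_singleton (μ := volume) τ)] with s h0 hτ hs
    have hs' : s ∈ Ioo 0 τ := ⟨lt_of_le_of_ne hs.1 (Ne.symm h0), lt_of_le_of_ne hs.2 hτ⟩
    exact Or.inl ⟨hH s hs', hd s hs'⟩

end IsSwitchedCurve

/-- Picard-Lindelöf for an autonomous field, with control of the solution. -/
theorem exists_flow_line [CompleteSpace E] {F : E → E} {c : E} {a r τ : ℝ} {K C : NNReal}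
    (hr : 0 ≤ r) (ha : 0 ≤ a)
    (hF : LipschitzOnWith K F (closedBall c a)) (hC : ∀ p ∈ closedBall c a, ‖F p‖ ≤ C)
    (hτ : 0 ≤ τ) (hτC : C * τ ≤ a - r) {p : E} (hp : p ∈ closedBall c r) :
    ∃ φ : ℝ → E, φ 0 = p ∧ LipschitzOnWith C φ (Icc 0 τ) ∧
      (∀ t ∈ Icc 0 τ, φ t ∈ closedBall c a) ∧
      ∀ t ∈ Ioo 0 τ, HasDerivAt φ (F (φ t)) t := by
  lift r to NNReal using hr
  lift a to NNReal using ha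
  have hpl : IsPicardLindelof (fun _ => F) (tmin := 0) (tmax := τ) ⟨0, le_rfl, hτ⟩ c a r C K :=
    IsPicardLindelof.of_time_independent hC hF (by simpa [hτ] using hτC)
  obtain ⟨α, hα⟩ := ODE.FunSpace.exists_isFixedPt_next hpl hp
  have hmem : ∀ t, α.compProj t ∈ closedBall c a :=
    fun t => α.compProj_mem_closedBall hpl.mul_max_le
  refine ⟨α.compProj, ?_, ?_, fun t _ => hmem t, fun t ht => ?_⟩
  · have := ODE.FunSpace.compProj_val (α := α) (t := ⟨0, le_rfl, hτ⟩)
    rw [this, ← hα, ODE.FunSpace.next_apply₀]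
  · refine LipschitzOnWith.of_dist_le_mul fun s hs t ht => ?_
    rw [ODE.FunSpace.compProj_of_mem hs, ODE.FunSpace.compProj_of_mem ht]
    exact α.lipschitzWith.dist_le_mul _ _
  · have ht' := Ioo_subset_Icc_self ht
    -- The fixed point coincides on the interval with its own Picard integral, whose derivative is
    -- the field along the curve.
    have h1 := ODE.hasDerivWithinAt_picard_Icc (f := fun _ => F) (t₀ := 0) (α := α.compProj)
      ⟨le_rfl, hτ⟩ hpl.continuousOn_uncurry
      α.continuous_compProj.continuousOn (fun t _ => hmem t) p ht'
    refine (h1.congr_of_mem (fun s hs => ?_) ht').hasDerivAt (Icc_mem_nhds ht.1 ht.2)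
    nth_rw 1 [← hα]
    rw [ODE.FunSpace.compProj_of_mem hs, ODE.FunSpace.next_apply]

/-- From a point of `{H = 0}` at which `Fp` points strictly into `{H > 0}`, follow `Fp`. -/
theorem exists_switchedCurve_of_transversal [CompleteSpace E] {Fp Fm : E → E} {H : E → ℝ}
    {H' : E → E →L[ℝ] ℝ} {c : E} {a r τ : ℝ} {K C : NNReal} (hr : 0 ≤ r) (ha : 0 ≤ a)
    (hF : LipschitzOnWith K Fp (closedBall c a)) (hC : ∀ p ∈ closedBall c a, ‖Fp p‖ ≤ C)
    (hH : ∀ p ∈ closedBall c a, HasFDerivAt H (H' p) p)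
    (hτ : 0 ≤ τ) (hτC : C * τ ≤ a - r) {p : E} (hp : p ∈ closedBall c r) (hHp : H p = 0)
    (hpos : ∀ q ∈ closedBall c a, dist q p ≤ C * τ → 0 < H' q (Fp q)) :
    ∃ φ : ℝ → E, φ 0 = p ∧ IsSwitchedCurve Fp Fm H C τ φ := by
  obtain ⟨φ, h0, hl, hmem, hd⟩ := exists_flow_line hr ha hF hC hτ hτC hp
  have hcont : ContinuousOn (fun t => H (φ t)) (Icc 0 τ) := fun t ht =>
    (hH _ (hmem t ht)).continuousAt.comp_continuousWithinAt (hl.continuousOn t ht)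
  have hmono : StrictMonoOn (fun t => H (φ t)) (Icc 0 τ) := by
    refine strictMonoOn_of_deriv_pos (convex_Icc _ _) hcont fun t ht => ?_
    rw [interior_Icc] at ht
    have ht' := Ioo_subset_Icc_self ht
    have h1 : HasDerivAt (fun t => H (φ t)) (H' (φ t) (Fp (φ t))) t :=
      (hH _ (hmem t ht')).comp_hasDerivAt t (hd t ht)
    rw [h1.deriv]
    refine hpos _ (hmem t ht') ?_
    have h2 := hl.dist_le_mul t ht' 0 ⟨le_rfl, hτ⟩
    rw [h0] at h2
    refine h2.trans (mul_le_mul_of_nonneg_left ?_ C.2)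
    rw [Real.dist_0_eq_abs, abs_of_nonneg ht'.1]
    exact ht'.2
  refine ⟨φ, h0, .of_pos hl hd fun t ht => ?_⟩
  have := hmono ⟨le_rfl, hτ⟩ (Ioo_subset_Icc_self ht) ht.1
  simpa [h0, hHp] using this

/-- From a point of `{H > 0}`, follow `Fp` until `{H = 0}` is reached, and continue from there. -/
theorem exists_switchedCurve_of_pos [CompleteSpace E] {Fp Fm : E → E} {H : E → ℝ}
    {c : E} {a r τ : ℝ} {K C : NNReal} (hr : 0 ≤ r) (ha : 0 ≤ a)
    (hF : LipschitzOnWith K Fp (closedBall c a)) (hC : ∀ p ∈ closedBall c a, ‖Fp p‖ ≤ C)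
    (hH : ∀ p ∈ closedBall c a, ContinuousAt H p)
    (hτ : 0 ≤ τ) (hτC : C * τ ≤ a - r)
    (hzero : ∀ p ∈ closedBall c a, H p = 0 →
      ∃ φ : ℝ → E, φ 0 = p ∧ IsSwitchedCurve Fp Fm H C τ φ)
    {p : E} (hp : p ∈ closedBall c r) (hHp : 0 < H p) :
    ∃ φ : ℝ → E, φ 0 = p ∧ IsSwitchedCurve Fp Fm H C τ φ := by
  obtain ⟨φ, h0, hl, hmem, hd⟩ := exists_flow_line hr ha hF hC hτ hτC hp
  by_cases hall : ∀ t ∈ Ioo 0 τ, 0 < H (φ t)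
  · exact ⟨φ, h0, .of_pos hl hd hall⟩
  push Not at hall
  obtain ⟨s, hs, hsH⟩ := hall
  have hcont : ContinuousOn (fun t => -H (φ t)) (Icc 0 τ) := fun t ht =>
    ((hH _ (hmem t ht)).comp_continuousWithinAt (hl.continuousOn t ht)).neg
  -- The first return to `{H = 0}`; before it `Fp` is the correct field, and the continuation is
  -- supplied from there.
  obtain ⟨t, ht0, hts, htH, hbelow⟩ := exists_first_hit (R := 0) hcont (by simpa [h0] using hHp)
    (Ioo_subset_Icc_self hs) (by simpa using hsH)
  have htτ : t ≤ τ := hts.trans hs.2.le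
  obtain ⟨ψ, hψ0, hψ⟩ := hzero (φ t) (hmem t ⟨ht0.le, htτ⟩) (by simpa using htH)
  have hφt : IsSwitchedCurve Fp Fm H C t φ :=
    .of_pos (hl.mono (Icc_subset_Icc_right htτ)) (fun u hu => hd u ⟨hu.1, hu.2.trans_le htτ⟩)
      fun u hu => by simpa using hbelow u ⟨hu.1.le, hu.2⟩
  obtain ⟨χ, hχ0, hχ⟩ := hφt.concat hψ ht0.le hτ hψ0
  exact ⟨χ, hχ0.trans h0, hχ.mono (by linarith)⟩

/-- Local existence of switched curves for a uniform time, when the normal velocity of `Fp` exceeds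
that of `Fm` by a uniform amount. -/
theorem exists_switchedCurve_local [CompleteSpace E] {Fp Fm : E → E} {H : E → ℝ}
    {H' : E → E →L[ℝ] ℝ} {c : E} {a r δ : ℝ} {K C : NNReal} (hr : 0 ≤ r) (hra : r < a)
    (hFp : LipschitzOnWith K Fp (closedBall c a)) (hFm : LipschitzOnWith K Fm (closedBall c a))
    (hCp : ∀ p ∈ closedBall c a, ‖Fp p‖ ≤ C) (hCm : ∀ p ∈ closedBall c a, ‖Fm p‖ ≤ C)
    (hH : ∀ p ∈ closedBall c a, HasFDerivAt H (H' p) p)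
    (hup : UniformContinuousOn (fun p => H' p (Fp p)) (closedBall c a))
    (hum : UniformContinuousOn (fun p => H' p (Fm p)) (closedBall c a))
    (hδ : 0 < δ) (hgap : ∀ p ∈ closedBall c a, 2 * δ ≤ H' p (Fp p) - H' p (Fm p)) :
    ∃ τ > 0, ∀ p ∈ closedBall c r, ∃ φ : ℝ → E, φ 0 = p ∧ IsSwitchedCurve Fp Fm H C τ φ := by
  obtain ⟨ηp, hηp, hup'⟩ := Metric.uniformContinuousOn_iff.mp hup δ hδ
  obtain ⟨ηm, hηm, hum'⟩ := Metric.uniformContinuousOn_iff.mp hum δ hδ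
  -- A displacement at most `η` changes either normal velocity by less than `δ` and moves at most
  -- half way from radius `r` to radius `a`.
  set η := min (min (ηp / 2) (ηm / 2)) ((a - r) / 2) with hη
  have hη0 : 0 < η := lt_min (lt_min (by positivity) (by positivity)) (by linarith)
  have h1 : η < ηp := lt_of_le_of_lt ((min_le_left _ _).trans (min_le_left _ _)) (by linarith)
  have h2 : η < ηm := lt_of_le_of_lt ((min_le_left _ _).trans (min_le_right _ _)) (by linarith)
  have h3 : η ≤ (a - r) / 2 := min_le_right _ _
  set τ := η / (C + 1) with hτ
  have hτ0 : 0 < τ := by positivity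
  have hCτ : C * τ ≤ η := by
    have : (C + 1) * τ = η := by rw [hτ]; field_simp
    linarith
  set b := (r + a) / 2 with hb
  -- The intermediate radius leaves room for two stages: from the `r`-ball to a switching point in
  -- the `b`-ball, then onwards within the `a`-ball.
  have hbsub : closedBall c b ⊆ closedBall c a :=
    Metric.closedBall_subset_closedBall (by linarith)
  have hzero : ∀ p ∈ closedBall c b, H p = 0 →
      ∃ φ : ℝ → E, φ 0 = p ∧ IsSwitchedCurve Fp Fm H C τ φ := by
    intro p hp hHp
    have hpa := hbsub hp
    -- A gap of `2δ` forces either `H' Fp ≥ δ` or `H' Fm < -δ`. Some field thus points strictly into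
    -- its own region, and keeps doing so over the displacement `C τ ≤ η`.
    by_cases hcase : δ ≤ H' p (Fp p)
    · refine exists_switchedCurve_of_transversal (by linarith) (by linarith) hFp hCp hH hτ0.le
        (by linarith) hp hHp fun q hq hqp => ?_
      have := hup' q hq p hpa (by linarith)
      rw [Real.dist_eq, abs_lt] at this
      linarith
    · have hg := hgap p hpa
      obtain ⟨φ, h0, hφ⟩ := exists_switchedCurve_of_transversal (Fp := Fm) (Fm := Fp)
        (H := fun p => -H p) (H' := fun p => -H' p) (τ := τ) (r := b) (by linarith) (by linarith)
        hFm hCm (fun p hp => (hH p hp).neg) hτ0.le (by linarith) hp (by simpa using hHp)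
        fun q hq hqp => by
          have := hum' q hq p hpa (by linarith)
          rw [Real.dist_eq, abs_lt] at this
          simp only [neg_apply]
          linarith
      exact ⟨φ, h0, by simpa using hφ.swap⟩
  refine ⟨τ, hτ0, fun p hp => ?_⟩
  rcases lt_trichotomy (H p) 0 with h | h | h
  · obtain ⟨φ, h0, hφ⟩ := exists_switchedCurve_of_pos (Fp := Fm) (Fm := Fp)
      (H := fun p => -H p) (τ := τ) (a := b) (r := r) hr (by linarith)
      (hFm.mono hbsub) (fun p hp => hCm p (hbsub hp))
      (fun p hp => (hH p (hbsub hp)).continuousAt.neg) hτ0.le (by linarith)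
      (fun p hp hp0 => by
        obtain ⟨φ, h0, hφ⟩ := hzero p hp (by simpa using hp0)
        exact ⟨φ, h0, hφ.swap⟩) hp (by simpa using h)
    exact ⟨φ, h0, by simpa using hφ.swap⟩
  · exact hzero p (Metric.closedBall_subset_closedBall (by linarith) hp) h
  · exact exists_switchedCurve_of_pos (a := b) (r := r) hr (by linarith)
      (hFp.mono hbsub) (fun p hp => hCp p (hbsub hp))
      (fun p hp => (hH p (hbsub hp)).continuousAt) hτ0.le (by linarith) hzero hp h

/-- Continuation of switched curves up to time `T`, given an a priori bound. -/
theorem exists_switchedCurve_of_apriori {Fp Fm : E → E} {H : E → ℝ} {C : NNReal} {U : Set E}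
    {τ T : ℝ} (hτ : 0 < τ) (hT : 0 ≤ T)
    (hloc : ∀ p ∈ U, ∃ φ : ℝ → E, φ 0 = p ∧ IsSwitchedCurve Fp Fm H C τ φ) {p : E}
    (hap : ∀ σ ∈ Icc 0 T, ∀ φ : ℝ → E, φ 0 = p → IsSwitchedCurve Fp Fm H C σ φ → φ σ ∈ U) :
    ∃ φ : ℝ → E, φ 0 = p ∧ IsSwitchedCurve Fp Fm H C T φ := by
  -- Each step gains the same time `τ`, since the a priori bound returns the endpoint to `U`; no
  -- accumulation of shrinking steps can occur.
  have key : ∀ k : ℕ, ∃ φ : ℝ → E, φ 0 = p ∧ IsSwitchedCurve Fp Fm H C (min (k * τ) T) φ := by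
    intro k
    induction k with
    | zero =>
      refine ⟨fun _ => p, rfl, ?_⟩
      rw [Nat.cast_zero, zero_mul, min_eq_left hT]
      exact .of_pos (LipschitzWith.const p |>.weaken zero_le).lipschitzOnWith
        (fun t ht => absurd (ht.1.trans ht.2) (lt_irrefl _))
        fun t ht => absurd (ht.1.trans ht.2) (lt_irrefl _)
    | succ k ih =>
      obtain ⟨φ, h0, hφ⟩ := ih
      have hnn : 0 ≤ min (k * τ) T := le_min (by positivity) hT
      obtain ⟨ψ, hψ0, hψ⟩ := hloc _ (hap _ ⟨hnn, min_le_right _ _⟩ φ h0 hφ)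
      obtain ⟨χ, hχ0, hχ⟩ := hφ.concat hψ hnn hτ.le hψ0
      refine ⟨χ, hχ0.trans h0, hχ.mono ?_⟩
      push_cast
      rw [← min_add_add_right, add_mul, one_mul]
      exact min_le_min le_rfl (by linarith)
  obtain ⟨k, hk⟩ := exists_nat_gt (T / τ)
  obtain ⟨φ, h0, hφ⟩ := key k
  rw [div_lt_iff₀ hτ] at hk
  rw [min_eq_right hk.le] at hφ
  exact ⟨φ, h0, hφ⟩

end SwitchedFlow

/-! ### A priori estimates in blown-up coordinates -/

section Estimates

variable {n m : ℕ}

/-- Uniform boundedness of a stable linear system with bounded forcing, in fast time `s / ε`. -/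
theorem norm_sq_le_of_lyapunov {A P : EuclideanSpace ℝ (Fin m) →L[ℝ] EuclideanSpace ℝ (Fin m)}
    {κ ε E z₀ T : ℝ} (hκ : 0 < κ) (hε : 0 < ε) (hE : 0 ≤ E)
    (hsymm : ∀ z w, ⟪P z, w⟫_ℝ = ⟪z, P w⟫_ℝ) (hpos : ∀ z, ‖z‖ ^ 2 ≤ ⟪P z, z⟫_ℝ)
    (hlyap : ∀ z, ⟪P z, A z⟫_ℝ ≤ -κ * ‖z‖ ^ 2) {Z : ℝ → EuclideanSpace ℝ (Fin m)}
    (hZ : AbsolutelyContinuousOnInterval Z 0 T) (hZ0 : ‖Z 0‖ ≤ z₀)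
    (hd : ∀ᵐ s : ℝ, s ∈ Icc 0 T → ∃ e, ‖e‖ ≤ E ∧ HasDerivAt Z (ε⁻¹ • (A (Z s) + e)) s) :
    ∀ t ∈ Icc 0 T, ‖Z t‖ ^ 2 ≤ ‖P‖ * max z₀ (‖P‖ * E / κ) ^ 2 := by
  -- Beyond radius `‖P‖E/κ` the damping `κ‖Z‖²` dominates the forcing `‖P‖‖Z‖E`. Exceeding the level
  -- `‖P‖w²` of the form implies `‖Z‖ ≥ w`, so that level is a barrier.
  set w := max z₀ (‖P‖ * E / κ) with hw
  have hw0 : 0 ≤ w := le_max_of_le_right (by positivity)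
  have hV : ∀ z, ⟪P z, z⟫_ℝ ≤ ‖P‖ * ‖z‖ ^ 2 := fun z =>
    calc ⟪P z, z⟫_ℝ ≤ ‖P z‖ * ‖z‖ := real_inner_le_norm _ _
      _ ≤ ‖P‖ * ‖z‖ * ‖z‖ := by gcongr; exact P.le_opNorm z
      _ = ‖P‖ * ‖z‖ ^ 2 := by ring
  have hac : AbsolutelyContinuousOnInterval (fun t => ⟪P (Z t), Z t⟫_ℝ) 0 T :=
    hZ.comp_contDiff (ψ := fun z => ⟪P z, z⟫_ℝ) (P.contDiff.inner ℝ contDiff_id)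
  have hbar := hac.le_of_barrier (K := ‖P‖ * w ^ 2)
    ((hV _).trans (by gcongr; exact hZ0.trans (le_max_left _ _))) (by
    filter_upwards [hd] with s hs hsT hlt
    obtain ⟨e, he, hds⟩ := hs hsT
    have hwZ : w ≤ ‖Z s‖ := by
      by_contra! hcon
      have : ‖P‖ * ‖Z s‖ ^ 2 ≤ ‖P‖ * w ^ 2 := by gcongr
      linarith [hV (Z s)]
    refine ⟨_, ?_, (P.hasFDerivAt.comp_hasDerivAt s hds).inner ℝ hds⟩
    have e1 : ⟪P (ε⁻¹ • (A (Z s) + e)), Z s⟫_ℝ = ⟪P (Z s), ε⁻¹ • (A (Z s) + e)⟫_ℝ := by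
      rw [hsymm, real_inner_comm]
    rw [Function.comp_apply, e1, real_inner_smul_right, inner_add_right]
    have h1 := hlyap (Z s)
    have h2 : ⟪P (Z s), e⟫_ℝ ≤ ‖P‖ * ‖Z s‖ * E :=
      (real_inner_le_norm _ _).trans (by gcongr; exact P.le_opNorm _)
    have h3 : ‖P‖ * E ≤ κ * ‖Z s‖ := by
      have := (le_max_right z₀ (‖P‖ * E / κ)).trans hwZ
      rw [div_le_iff₀ hκ] at this
      linarith
    have h4 : ⟪P (Z s), A (Z s)⟫_ℝ + ⟪P (Z s), e⟫_ℝ ≤ 0 := by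
      nlinarith [norm_nonneg (Z s)]
    have h5 : 0 ≤ ε⁻¹ := by positivity
    nlinarith)
  exact fun t ht => (hpos _).trans (hbar t ht)

/-- A priori bounds for the blown-up coordinates `ξ`, `η` of a slow-fast curve: as long as the
linearised fast equation holds up to an error of size one in the ball of radius `R`, the curve
stays in that ball, and the distance to the slow manifold is bounded independently of `R`. -/
theorem blowup_bounds {A P Ainv : EuclideanSpace ℝ (Fin m) →L[ℝ] EuclideanSpace ℝ (Fin m)}
    {G : EuclideanSpace ℝ (Fin n) →L[ℝ] EuclideanSpace ℝ (Fin m)}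
    {q : EuclideanSpace ℝ (Fin m)}
    {κ ε T M R KZ ρx ρy ρt : ℝ} (hκ : 0 < κ) (hε : 0 < ε) (hM : 0 ≤ M) (hT : T ≤ ε * ρt)
    (hAinv : ∀ z, A (Ainv z) = z)
    (hsymm : ∀ z w, ⟪P z, w⟫_ℝ = ⟪z, P w⟫_ℝ) (hpos : ∀ z, ‖z‖ ^ 2 ≤ ⟪P z, z⟫_ℝ)
    (hlyap : ∀ z, ⟪P z, A z⟫_ℝ ≤ -κ * ‖z‖ ^ 2)
    {ξ : ℝ → EuclideanSpace ℝ (Fin n)} {η : ℝ → EuclideanSpace ℝ (Fin m)}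
    (hξ : AbsolutelyContinuousOnInterval ξ 0 T) (hη : AbsolutelyContinuousOnInterval η 0 T)
    (hξ0 : ‖ξ 0‖ ≤ ρx) (hη0 : ‖η 0‖ ≤ ρy)
    (hslow : ∀ᵐ s : ℝ, s ∈ Icc 0 T → max ‖ξ s‖ ‖η s‖ ≤ R →
      ∃ v, ‖v‖ ≤ M ∧ HasDerivAt ξ (ε⁻¹ • v) s)
    (hfast : ∀ᵐ s : ℝ, s ∈ Icc 0 T → max ‖ξ s‖ ‖η s‖ ≤ R →
      ∃ e, ‖e‖ ≤ 1 ∧ HasDerivAt η (ε⁻¹ • (G (ξ s) + A (η s) + q + e)) s)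
    (hKZ0 : 0 ≤ KZ)
    (hKZ : ‖P‖ * max (ρy + ‖Ainv.comp G‖ * ρx + ‖Ainv q‖)
      (‖P‖ * (1 + ‖Ainv.comp G‖ * M) / κ) ^ 2 ≤ KZ ^ 2)
    (hRx : ρx + M * ρt < R) (hRy : KZ + ‖Ainv.comp G‖ * (ρx + M * ρt) + ‖Ainv q‖ < R)
    (hxy : max ρx ρy < R) :
    ∀ s ∈ Icc 0 T, max ‖ξ s‖ ‖η s‖ < R ∧ ‖η s + Ainv.comp G (ξ s) + Ainv q‖ ≤ KZ := by
  rcases lt_or_ge T 0 with hT0 | hT0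
  · intro s hs
    exact absurd (hs.1.trans hs.2) (not_le.mpr hT0)
  set J := Ainv.comp G with hJ
  have hAJ : ∀ u, A (J u) = G u := fun u => hAinv _
  -- The non-strict bound by `R` makes the linearised equations available and yields a strict bound,
  -- which continuous induction then makes unconditional.
  have hstep : ∀ s ∈ Icc 0 T, (∀ t ∈ Icc 0 s, max ‖ξ t‖ ‖η t‖ ≤ R) →
      max ‖ξ s‖ ‖η s‖ < R ∧ ‖η s + J (ξ s) + Ainv q‖ ≤ KZ := by
    intro s hs hR
    have hsub : uIcc 0 s ⊆ uIcc 0 T := by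
      rw [uIcc_of_le hs.1, uIcc_of_le hT0]
      exact Icc_subset_Icc_right hs.2
    have hξs := hξ.mono hsub
    have hηs := hη.mono hsub
    have h1 : ‖ξ s - ξ 0‖ ≤ ε⁻¹ * M * (s - 0) := by
      refine hξs.norm_sub_le_of_ae_hasDerivAt hs.1 ?_
      filter_upwards [hslow] with t ht hts
      obtain ⟨v, hv, hvt⟩ := ht ⟨hts.1, hts.2.trans hs.2⟩ (hR t hts)
      refine ⟨_, ?_, hvt⟩
      rw [norm_smul, Real.norm_of_nonneg (by positivity)]
      gcongr
    have h2 : ‖ξ s‖ ≤ ρx + M * ρt := by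
      have e1 : ‖ξ s‖ ≤ ‖ξ 0‖ + ‖ξ s - ξ 0‖ := norm_le_norm_add_norm_sub' _ _
      have e2 : ε⁻¹ * M * (s - 0) ≤ M * ρt := by
        have : ε⁻¹ * s ≤ ρt := by
          rw [inv_mul_le_iff₀ hε]
          exact hs.2.trans hT
        nlinarith
      linarith
    have h3 : ‖η s + J (ξ s) + Ainv q‖ ≤ KZ := by
      -- For `Z = η + Jξ + Ainv q` one has `A Z = Gξ + Aη + q`, so the fast equation becomes `ε Z' =
      -- A Z + (e + J v)`, a forcing free of `R` and `ρt`.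
      have hac : AbsolutelyContinuousOnInterval (fun t => η t + J (ξ t) + Ainv q) 0 s :=
        (hηs.fun_add (hξs.comp_contDiff J.contDiff)).fun_add
          (contDiff_const.contDiffOn.absolutelyContinuousOnInterval)
      have h0 : ‖η 0 + J (ξ 0) + Ainv q‖ ≤ ρy + ‖J‖ * ρx + ‖Ainv q‖ := by
        refine (norm_add₃_le).trans ?_
        gcongr
        exact (J.le_opNorm _).trans (by gcongr)
      have := norm_sq_le_of_lyapunov (E := 1 + ‖J‖ * M) hκ hε (by positivity) hsymm hpos hlyap
        hac h0 (by
          filter_upwards [hslow, hfast] with t ht ht' hts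
          have htT : t ∈ Icc 0 T := ⟨hts.1, hts.2.trans hs.2⟩
          obtain ⟨v, hv, hvt⟩ := ht htT (hR t hts)
          obtain ⟨e, he, het⟩ := ht' htT (hR t hts)
          refine ⟨e + J v, (norm_add_le _ _).trans ?_, ?_⟩
          · gcongr
            exact (J.le_opNorm _).trans (by gcongr)
          · have hd := (het.add (J.hasFDerivAt.comp_hasDerivAt t hvt)).add_const (Ainv q)
            refine hd.congr_deriv ?_
            rw [map_add, map_add, hAJ, hAinv, map_smul, ← smul_add]
            congr 1
            abel) s ⟨hs.1, le_rfl⟩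
      exact (sq_le_sq₀ (norm_nonneg _) hKZ0).mp (this.trans hKZ)
    refine ⟨max_lt (h2.trans_lt hRx) ?_, h3⟩
    have e1 : η s = (η s + J (ξ s) + Ainv q) - J (ξ s) - Ainv q := by abel
    have e2 : ‖J (ξ s)‖ ≤ ‖J‖ * (ρx + M * ρt) := (J.le_opNorm _).trans (by gcongr)
    rw [e1]
    have e3 := norm_sub_le (η s + J (ξ s) + Ainv q - J (ξ s)) (Ainv q)
    have e4 := norm_sub_le (η s + J (ξ s) + Ainv q) (J (ξ s))
    linarith
  have hcont : ContinuousOn (fun s => max ‖ξ s‖ ‖η s‖) (Icc 0 T) := by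
    have h1 := hξ.continuousOn
    have h2 := hη.continuousOn
    rw [uIcc_of_le hT0] at h1 h2
    exact ContinuousOn.sup h1.norm h2.norm
  have hlt := lt_of_bootstrap hcont ((max_le_max hξ0 hη0).trans_lt hxy)
    fun s hs hR => (hstep s hs hR).1
  exact fun s hs => hstep s hs fun t ht => (hlt t ⟨ht.1, ht.2.trans hs.2⟩).le

/-- A linear functional that cannot grow in modulus beyond `K` along a curve stays bounded. -/
theorem abs_le_of_barrier {F : Type*} [NormedAddCommGroup F] [NormedSpace ℝ F] [ProperSpace F]
    {ξ : ℝ → F} {T ε K : ℝ} (hε : 0 < ε) (ℓ : F →L[ℝ] ℝ)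
    (hξ : AbsolutelyContinuousOnInterval ξ 0 T) (h0 : |ℓ (ξ 0)| ≤ K)
    (hd : ∀ᵐ s : ℝ, s ∈ Icc 0 T → ∃ v, HasDerivAt ξ (ε⁻¹ • v) s ∧
      (K < ℓ (ξ s) → ℓ v ≤ 0) ∧ (ℓ (ξ s) < -K → 0 ≤ ℓ v)) :
    ∀ s ∈ Icc 0 T, |ℓ (ξ s)| ≤ K := by
  have hε' : 0 < ε⁻¹ := by positivity
  have h1 := (hξ.comp_contDiff ℓ.contDiff).le_of_barrier (abs_le.mp h0).2 (by
    filter_upwards [hd] with s hs hsT hlt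
    obtain ⟨v, hv, hvp, -⟩ := hs hsT
    refine ⟨_, ?_, ℓ.hasFDerivAt.comp_hasDerivAt s hv⟩
    rw [map_smul, smul_eq_mul]
    nlinarith [hvp hlt])
  have h2 := (hξ.comp_contDiff (-ℓ).contDiff).le_of_barrier (K := K)
    (by rw [neg_apply]; linarith [(abs_le.mp h0).1]) (by
    filter_upwards [hd] with s hs hsT hlt
    obtain ⟨v, hv, -, hvm⟩ := hs hsT
    refine ⟨_, ?_, (-ℓ).hasFDerivAt.comp_hasDerivAt s hv⟩
    rw [neg_apply] at hlt
    rw [map_smul, smul_eq_mul, neg_apply]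
    nlinarith [hvm (by linarith)])
  intro s hs
  have h2s := h2 s hs
  rw [neg_apply] at h2s
  exact abs_le.mpr ⟨by linarith, h1 s hs⟩

/-! ### Linearisation on balls of radius proportional to `ε` -/

/-- First-order expansion in blown-up coordinates, uniformly on balls. -/
theorem HasFDerivAt.eventually_blowup {W V : Type*} [NormedAddCommGroup W] [NormedSpace ℝ W]
    [NormedAddCommGroup V] [NormedSpace ℝ V] {F : W → V} {F' : W →L[ℝ] V} {p : W}
    (hF : HasFDerivAt F F' p) (hp : F p = 0) {R c : ℝ} (hR : 0 < R) (hc : 0 < c) :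
    ∀ᶠ ε in 𝓝[>] (0 : ℝ), ∀ w, ‖w‖ ≤ R → ‖ε⁻¹ • F (p + ε • w) - F' w‖ ≤ c := by
  have h := hF.isLittleO.def (c := c / R) (by positivity)
  obtain ⟨δ, hδ, hball⟩ := Metric.eventually_nhds_iff_ball.mp h
  have h1 : ∀ᶠ ε in 𝓝[>] (0 : ℝ), ε < δ / R :=
    mem_nhdsWithin_of_mem_nhds (Iio_mem_nhds (by positivity : (0 : ℝ) < δ / R))
  filter_upwards [h1, self_mem_nhdsWithin] with ε hε hε0 w hw
  have hε0 : 0 < ε := hε0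
  have hnorm : ‖ε • w‖ ≤ ε * R := by
    rw [norm_smul, Real.norm_of_nonneg hε0.le]
    gcongr
  have h2 := hball (p + ε • w) (by
    rw [mem_ball_iff_norm, add_sub_cancel_left]
    exact hnorm.trans_lt ((lt_div_iff₀ hR).mp hε))
  rw [hp, sub_zero, add_sub_cancel_left, map_smul] at h2
  have h3 : ε⁻¹ • F (p + ε • w) - F' w = ε⁻¹ • (F (p + ε • w) - ε • F' w) := by
    rw [smul_sub, inv_smul_smul₀ hε0.ne']
  rw [h3, norm_smul, Real.norm_of_nonneg (by positivity), inv_mul_le_iff₀ hε0]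
  calc _ ≤ c / R * ‖ε • w‖ := h2
    _ ≤ c / R * (ε * R) := by gcongr
    _ = ε * c := by field_simp

/-- Continuity in blown-up coordinates, uniformly on balls. -/
theorem ContinuousAt.eventually_blowup {W V : Type*} [NormedAddCommGroup W] [NormedSpace ℝ W]
    [NormedAddCommGroup V] {F : W → V} {p : W}
    (hF : ContinuousAt F p) {R c : ℝ} (hR : 0 < R) (hc : 0 < c) :
    ∀ᶠ ε in 𝓝[>] (0 : ℝ), ∀ w, ‖w‖ ≤ R → ‖F (p + ε • w) - F p‖ ≤ c := by
  obtain ⟨δ, hδ, hball⟩ := Metric.continuousAt_iff.mp hF c hc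
  have h1 : ∀ᶠ ε in 𝓝[>] (0 : ℝ), ε < δ / R :=
    mem_nhdsWithin_of_mem_nhds (Iio_mem_nhds (by positivity : (0 : ℝ) < δ / R))
  filter_upwards [h1, self_mem_nhdsWithin] with ε hε hε0 w hw
  have hε0 : 0 < ε := hε0
  have hnorm : ‖ε • w‖ ≤ ε * R := by
    rw [norm_smul, Real.norm_of_nonneg hε0.le]
    gcongr
  have := hball (x := p + ε • w) (by
    rw [dist_eq_norm, add_sub_cancel_left]
    exact hnorm.trans_lt ((lt_div_iff₀ hR).mp hε))
  rw [dist_eq_norm] at this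
  exact this.le

/-- The total derivative in terms of partial derivatives. -/
theorem fderiv_apply_eq_partial {X Y V : Type*} [NormedAddCommGroup X] [NormedSpace ℝ X]
    [NormedAddCommGroup Y] [NormedSpace ℝ Y] [NormedAddCommGroup V] [NormedSpace ℝ V]
    {F : X × Y × ℝ → V} {p : X × Y × ℝ} (hF : DifferentiableAt ℝ F p) (u : X) (v : Y) (w : ℝ) :
    fderiv ℝ F p (u, v, w) = fderiv ℝ (fun x => F (x, p.2.1, p.2.2)) p.1 u +
      fderiv ℝ (fun y => F (p.1, y, p.2.2)) p.2.1 v + w • fderiv ℝ F p (0, 0, 1) := by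
  have h1 : fderiv ℝ (fun x => F (x, p.2.1, p.2.2)) p.1 u = fderiv ℝ F p (u, 0, 0) := by
    have : HasFDerivAt (fun x : X => (x, p.2.1, p.2.2))
        ((ContinuousLinearMap.id ℝ X).prod 0) p.1 :=
      (hasFDerivAt_id p.1).prodMk (hasFDerivAt_const (p.2.1, p.2.2) p.1)
    have h := (HasFDerivAt.comp p.1 (show HasFDerivAt F (fderiv ℝ F p) (p.1, p.2.1, p.2.2) from
      hF.hasFDerivAt) this).fderiv
    simp only [Function.comp_def] at h
    rw [h]
    rfl
  have h2 : fderiv ℝ (fun y => F (p.1, y, p.2.2)) p.2.1 v = fderiv ℝ F p (0, v, 0) := by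
    have : HasFDerivAt (fun y : Y => (p.1, y, p.2.2))
        ((0 : Y →L[ℝ] X).prod ((ContinuousLinearMap.id ℝ Y).prod 0)) p.2.1 :=
      (hasFDerivAt_const p.1 p.2.1).prodMk
        ((hasFDerivAt_id p.2.1).prodMk (hasFDerivAt_const p.2.2 p.2.1))
    have h := (HasFDerivAt.comp p.2.1 (show HasFDerivAt F (fderiv ℝ F p) (p.1, p.2.1, p.2.2) from
      hF.hasFDerivAt) this).fderiv
    simp only [Function.comp_def] at h
    rw [h]
    rfl
  rw [h1, h2, ← map_smul, ← map_add, ← map_add]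
  simp

end Estimates

/-- An endomorphism of `ℝᵐ` with a strict quadratic Lyapunov function is inverted by its
`ContinuousLinearMap.inverse`. -/
theorem apply_inverse_apply_of_lyapunov {m : ℕ}
    {A P : EuclideanSpace ℝ (Fin m) →L[ℝ] EuclideanSpace ℝ (Fin m)} {κ : ℝ} (hκ : 0 < κ)
    (hlyap : ∀ z, ⟪P z, A z⟫_ℝ ≤ -κ * ‖z‖ ^ 2) (z : EuclideanSpace ℝ (Fin m)) :
    A (A.inverse z) = z := by
  have hinj : Function.Injective A.toLinearMap := by
    rw [injective_iff_map_eq_zero]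
    intro w hw
    have h := hlyap w
    rw [show A w = 0 from hw, inner_zero_right] at h
    have : ‖w‖ ^ 2 ≤ 0 := by nlinarith
    simpa using le_antisymm this (sq_nonneg _)
  let e := (LinearEquiv.ofInjectiveEndo A.toLinearMap hinj).toContinuousLinearEquiv
  have he : (e : EuclideanSpace ℝ (Fin m) →L[ℝ] EuclideanSpace ℝ (Fin m)) = A := by
    ext w : 1
    exact congrFun (LinearEquiv.coe_ofInjectiveEndo A.toLinearMap hinj) w
  rw [← he, ContinuousLinearMap.inverse_equiv]
  exact e.apply_symm_apply z

/-! ### Approximation by the reduced sliding flow -/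

namespace SlowFastSystem

variable {n m : ℕ} (S : SlowFastSystem n m)

/-- The projection of slow velocities along `f₋ - f₊` onto the kernel of `h_{rd,x}`. -/
noncomputable def slidingProj
    (p : EuclideanSpace ℝ (Fin n) × EuclideanSpace ℝ (Fin m) × ℝ) :
    EuclideanSpace ℝ (Fin n) →L[ℝ] EuclideanSpace ℝ (Fin n) :=
  ContinuousLinearMap.id ℝ _ -
    ((S.hrdx p (S.fMinus p - S.fPlus p))⁻¹ • S.hrdx p).smulRight (S.fMinus p - S.fPlus p)

variable {S} {p : EuclideanSpace ℝ (Fin n) × EuclideanSpace ℝ (Fin m) × ℝ}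

theorem slidingProj_apply (v : EuclideanSpace ℝ (Fin n)) :
    S.slidingProj p v = v - ((S.hrdx p (S.fMinus p - S.fPlus p))⁻¹ * S.hrdx p v) •
      (S.fMinus p - S.fPlus p) := by
  simp [slidingProj]

/-- The coefficient of `f₋ - f₊` removed by the projection is exactly `-α`, so `α` is what brings
`f₊` into the kernel of `h_{rd,x}` when the denominator is nonzero. -/
theorem slidingProj_fPlus : S.slidingProj p (S.fPlus p) = S.fRdS p := by
  rw [slidingProj_apply, fRdS, alphaRd, neg_smul, sub_eq_add_neg, div_eq_inv_mul]

/-- The two fields differ by the direction of projection, which is annihilated. -/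
theorem slidingProj_fMinus (h : S.hrdx p (S.fMinus p - S.fPlus p) ≠ 0) :
    S.slidingProj p (S.fMinus p) = S.fRdS p := by
  rw [← slidingProj_fPlus, ← sub_eq_zero, ← map_sub, slidingProj_apply, inv_mul_cancel₀ h,
    one_smul, sub_self]

/-- If both fields are within `c` of their values at `p`, the projection maps every Filippov
velocity close to the sliding velocity. -/
theorem norm_slidingProj_sub_le (h : S.hrdx p (S.fMinus p - S.fPlus p) ≠ 0)
    {a b v : EuclideanSpace ℝ (Fin n)} {c : ℝ} (ha : ‖a - S.fMinus p‖ ≤ c)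
    (hb : ‖b - S.fPlus p‖ ≤ c) (hv : v ∈ segment ℝ a b) :
    ‖S.slidingProj p v - S.fRdS p‖ ≤ ‖S.slidingProj p‖ * c := by
  have hconv : Convex ℝ (S.slidingProj p ⁻¹'
      Metric.closedBall (S.fRdS p) (‖S.slidingProj p‖ * c)) :=
    (convex_closedBall _ _).linear_preimage (S.slidingProj p).toLinearMap
  have ha' : a ∈ S.slidingProj p ⁻¹' Metric.closedBall (S.fRdS p) (‖S.slidingProj p‖ * c) := by
    rw [mem_preimage, mem_closedBall_iff_norm, ← slidingProj_fMinus h, ← map_sub]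
    exact ((S.slidingProj p).le_opNorm _).trans (by gcongr)
  have hb' : b ∈ S.slidingProj p ⁻¹' Metric.closedBall (S.fRdS p) (‖S.slidingProj p‖ * c) := by
    rw [mem_preimage, mem_closedBall_iff_norm, ← slidingProj_fPlus, ← map_sub]
    exact ((S.slidingProj p).le_opNorm _).trans (by gcongr)
  exact mem_closedBall_iff_norm.mp (hconv.segment_subset ha' hb' hv)

set_option maxHeartbeats 1000000 in
/-- Trajectories starting at distance `O(ε)` from a point of the intersection of the switching and
the slow manifold stay at distance `O(ε)` on times `O(ε)`, and follow the sliding vector field of the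
reduced system up to an error `ε ρf` that does not depend on the length of the time interval. -/
theorem eventually_trajectory_bounds {x₀ : EuclideanSpace ℝ (Fin n)}
    {y₀ : EuclideanSpace ℝ (Fin m)} (hsmooth : S.SmoothNear (x₀, y₀, 0))
    (hg0 : S.g (x₀, y₀, 0) = 0) (hh0 : S.h (x₀, y₀, 0) = 0) {c : ℝ} (hc : 0 < c)
    (hspec : ∀ μ ∈ S.specGy (x₀, y₀, 0), μ.re < -c)
    (hfp : S.hrdx (x₀, y₀, 0) (S.fPlus (x₀, y₀, 0)) < 0)
    (hfm : 0 < S.hrdx (x₀, y₀, 0) (S.fMinus (x₀, y₀, 0)))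
    {ρx ρy : ℝ} (hρx : 0 < ρx) (hρy : 0 < ρy) :
    ∃ ρf > 0, ∀ ρt > 0, ∃ R > 0, ∀ᶠ ε in 𝓝[>] (0 : ℝ), ∀ T ≤ ε * ρt,
      ∀ x y, S.IsTrajectory ε T x y → ‖x 0 - x₀‖ ≤ ε * ρx → ‖y 0 - y₀‖ ≤ ε * ρy →
      ∀ s ∈ Icc 0 T, ‖x s - x₀‖ ≤ ε * R ∧ ‖y s - y₀‖ ≤ ε * R ∧
        ‖x s - x 0 - s • S.fRdS (x₀, y₀, 0)‖ ≤ ε * ρf ∧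
        ‖y s - y 0 + s • S.gyInvGx (x₀, y₀, 0) (S.fRdS (x₀, y₀, 0))‖ ≤ ε * ρf := by
  obtain ⟨hsp, hsm, hsg, hsh⟩ := hsmooth
  set p₀ : EuclideanSpace ℝ (Fin n) × EuclideanSpace ℝ (Fin m) × ℝ := (x₀, y₀, 0) with hp₀
  obtain ⟨P, κ, hκ, hsymm, hpos, hlyap⟩ := exists_lyapunov (S.gy p₀) hc hspec
  have hAinv := apply_inverse_apply_of_lyapunov hκ hlyap
  have hdg : DifferentiableAt ℝ S.g p₀ := hsg.differentiableAt one_ne_zero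
  have hdh : DifferentiableAt ℝ S.h p₀ := hsh.differentiableAt one_ne_zero
  set A := S.gy p₀ with hA
  set J := S.gyInvGx p₀ with hJ
  set q := fderiv ℝ S.g p₀ (0, 0, 1) with hq
  set k := fderiv ℝ S.h p₀ (0, 0, 1) with hk
  set ℓ := S.hrdx p₀ with hℓ
  set Q := S.slidingProj p₀ with hQ
  set d := S.fMinus p₀ - S.fPlus p₀ with hd
  have hΔ : 0 < ℓ d := by rw [hd, map_sub]; linarith
  set M := max ‖S.fPlus p₀‖ ‖S.fMinus p₀‖ + 1 with hM
  have hM0 : 0 ≤ M := by positivity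
  set KZ := √(‖P‖ * max (ρy + ‖J‖ * ρx + ‖A.inverse q‖) (‖P‖ * (1 + ‖J‖ * M) / κ) ^ 2) with hKZ
  have hKZ0 : 0 ≤ KZ := Real.sqrt_nonneg _
  -- The initial size of `ℓ ξ` plus the largest discrepancy between `ℓ ξ` and `h/ε`. Beyond this
  -- level the sign of `h` is that of `ℓ ξ`.
  set Ku := ‖ℓ‖ * ρx + (‖S.hy p₀‖ * (KZ + ‖A.inverse q‖) + |k| + 1) with hKu
  set Bx := 1 + (ℓ d)⁻¹ * (2 * Ku) * ‖d‖ with hBx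
  have hBx0 : 0 < Bx := by positivity
  -- The error bound is fixed before `ρt` appears; only `R`, `c₁` and the range of `ε` may depend on
  -- `ρt`.
  refine ⟨Bx + (2 * KZ + ‖J‖ * Bx), by positivity, fun ρt hρt => ?_⟩
  set R := ρx + ρy + M * ρt + (KZ + ‖J‖ * (ρx + M * ρt) + ‖A.inverse q‖) + 1 with hR
  have hb1 : 0 ≤ KZ + ‖J‖ * (ρx + M * ρt) + ‖A.inverse q‖ := by positivity
  have hb2 : 0 ≤ M * ρt := by positivity
  have hR1 : 1 ≤ R := by linarith
  refine ⟨R, by linarith, ?_⟩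
  -- The tolerance for `f₊` and `f₋` serves three ends: speeds at most `M`, projected drift `‖Q‖c₁ρt
  -- ≤ 1`, and preserved signs of `ℓ f₊` and `ℓ f₋`.
  set c₁ := min (min 1 (1 / ((‖Q‖ + 1) * ρt)))
    (min (-ℓ (S.fPlus p₀) / (‖ℓ‖ + 1)) (ℓ (S.fMinus p₀) / (‖ℓ‖ + 1))) with hc₁
  have hc₁0 : 0 < c₁ := lt_min (lt_min one_pos (by positivity))
    (lt_min (div_pos (by linarith) (by positivity)) (by positivity))
  have hc₁1 : c₁ ≤ 1 := (min_le_left _ _).trans (min_le_left _ _)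
  have hc₁Q : ‖Q‖ * c₁ * ρt ≤ 1 := by
    have h1 : c₁ ≤ 1 / ((‖Q‖ + 1) * ρt) := (min_le_left _ _).trans (min_le_right _ _)
    rw [le_div_iff₀ (by positivity)] at h1
    nlinarith [mul_pos hc₁0 hρt]
  have hc₁p : ‖ℓ‖ * c₁ ≤ -ℓ (S.fPlus p₀) := by
    have h1 : c₁ ≤ -ℓ (S.fPlus p₀) / (‖ℓ‖ + 1) := (min_le_right _ _).trans (min_le_left _ _)
    rw [le_div_iff₀ (by positivity)] at h1
    linarith
  have hc₁m : ‖ℓ‖ * c₁ ≤ ℓ (S.fMinus p₀) := by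
    have h1 : c₁ ≤ ℓ (S.fMinus p₀) / (‖ℓ‖ + 1) := (min_le_right _ _).trans (min_le_right _ _)
    rw [le_div_iff₀ (by positivity)] at h1
    linarith
  have hR0 : 0 < R := by linarith
  filter_upwards [hsp.continuousAt.eventually_blowup hR0 hc₁0,
    hsm.continuousAt.eventually_blowup hR0 hc₁0,
    hdg.hasFDerivAt.eventually_blowup hg0 hR0 one_pos,
    hdh.hasFDerivAt.eventually_blowup hh0 hR0 one_pos, self_mem_nhdsWithin]
    with ε hεp hεm hεg hεh hε0 T hT x y hxy hx0 hy0
  have hε0 : 0 < ε := hε0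
  have hε' : 0 < ε⁻¹ := inv_pos.mpr hε0
  let ξ : ℝ → EuclideanSpace ℝ (Fin n) := fun s => ε⁻¹ • (x s - x₀)
  let η : ℝ → EuclideanSpace ℝ (Fin m) := fun s => ε⁻¹ • (y s - y₀)
  have hxξ : ∀ s, x s = x₀ + ε • ξ s := fun s => by simp [ξ, smul_inv_smul₀ hε0.ne']
  have hyη : ∀ s, y s = y₀ + ε • η s := fun s => by simp [η, smul_inv_smul₀ hε0.ne']
  have hξac : AbsolutelyContinuousOnInterval ξ 0 T :=
    hxy.absCont_x.comp_contDiff (ψ := fun u => ε⁻¹ • (u - x₀)) (by fun_prop)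
  have hηac : AbsolutelyContinuousOnInterval η 0 T :=
    hxy.absCont_y.comp_contDiff (ψ := fun u => ε⁻¹ • (u - y₀)) (by fun_prop)
  have hξd : ∀ {s v}, HasDerivAt x v s → HasDerivAt ξ (ε⁻¹ • v) s := fun h =>
    (h.sub_const x₀).const_smul ε⁻¹
  have hηd : ∀ {s v}, HasDerivAt y v s → HasDerivAt η (ε⁻¹ • v) s := fun h =>
    (h.sub_const y₀).const_smul ε⁻¹
  have hξ0 : ‖ξ 0‖ ≤ ρx := by
    simp only [ξ]
    rw [norm_smul, Real.norm_of_nonneg hε'.le, inv_mul_le_iff₀ hε0]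
    exact hx0
  have hη0 : ‖η 0‖ ≤ ρy := by
    simp only [η]
    rw [norm_smul, Real.norm_of_nonneg hε'.le, inv_mul_le_iff₀ hε0]
    exact hy0
  clear_value ξ η
  -- The parameter `ε` is itself a blown-up coordinate with value `1`; this is where `R ≥ 1` is
  -- needed.
  have hpt : ∀ s, (x s, y s, ε) = p₀ + ε • (ξ s, η s, (1 : ℝ)) := fun s => by
    rw [hxξ s, hyη s, hp₀]
    simp
  have hw : ∀ s, max ‖ξ s‖ ‖η s‖ ≤ R → ‖(ξ s, η s, (1 : ℝ))‖ ≤ R := fun s hs => by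
    rw [max_le_iff] at hs
    simp [Prod.norm_def, hs.1, hs.2, hR1]
  have hfpS : ∀ s, max ‖ξ s‖ ‖η s‖ ≤ R → ‖S.fPlus (x s, y s, ε) - S.fPlus p₀‖ ≤ c₁ :=
    fun s hs => by rw [hpt]; exact hεp _ (hw s hs)
  have hfmS : ∀ s, max ‖ξ s‖ ‖η s‖ ≤ R → ‖S.fMinus (x s, y s, ε) - S.fMinus p₀‖ ≤ c₁ :=
    fun s hs => by rw [hpt]; exact hεm _ (hw s hs)
  have hslow : ∀ᵐ s : ℝ, s ∈ Icc 0 T → max ‖ξ s‖ ‖η s‖ ≤ R →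
      ∃ v, ‖v‖ ≤ M ∧ HasDerivAt ξ (ε⁻¹ • v) s := by
    filter_upwards [hxy.slow] with s hs hsT hsR
    obtain ⟨v, hv, hvd⟩ := hs hsT
    refine ⟨v, ?_, hξd hvd⟩
    have h1 : S.fPlus (x s, y s, ε) ∈ Metric.closedBall 0 M := by
      rw [mem_closedBall_zero_iff]
      have := norm_le_norm_add_norm_sub' (S.fPlus (x s, y s, ε)) (S.fPlus p₀)
      linarith [hfpS s hsR, le_max_left ‖S.fPlus p₀‖ ‖S.fMinus p₀‖]
    have h2 : S.fMinus (x s, y s, ε) ∈ Metric.closedBall 0 M := by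
      rw [mem_closedBall_zero_iff]
      have := norm_le_norm_add_norm_sub' (S.fMinus (x s, y s, ε)) (S.fMinus p₀)
      linarith [hfmS s hsR, le_max_right ‖S.fPlus p₀‖ ‖S.fMinus p₀‖]
    exact mem_closedBall_zero_iff.mp ((convex_closedBall 0 M).segment_subset h2 h1 hv.2.2)
  have hfast : ∀ᵐ s : ℝ, s ∈ Icc 0 T → max ‖ξ s‖ ‖η s‖ ≤ R →
      ∃ e, ‖e‖ ≤ 1 ∧ HasDerivAt η (ε⁻¹ • (S.gx p₀ (ξ s) + A (η s) + q + e)) s := by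
    filter_upwards [hxy.fast] with s hs hsT hsR
    refine ⟨ε⁻¹ • S.g (x s, y s, ε) - (S.gx p₀ (ξ s) + A (η s) + q), ?_, ?_⟩
    · have h1 := hεg _ (hw s hsR)
      rw [← hpt, fderiv_apply_eq_partial hdg, one_smul] at h1
      exact h1
    · rw [add_sub_cancel]
      exact hηd (hs hsT)
  have hbd := blowup_bounds (G := S.gx p₀) hκ hε0 hM0 hT hAinv hsymm hpos hlyap hξac hηac hξ0 hη0
    hslow hfast hKZ0 (Real.sq_sqrt (by positivity)).ge (by linarith)
    (by change KZ + ‖J‖ * (ρx + M * ρt) + ‖A.inverse q‖ < R; linarith)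
    (max_lt (by linarith) (by linarith))
  have hbdR : ∀ s ∈ Icc 0 T, max ‖ξ s‖ ‖η s‖ ≤ R := fun s hs => (hbd s hs).1.le
  have hZ : ∀ s ∈ Icc 0 T, ‖η s + J (ξ s) + A.inverse q‖ ≤ KZ := fun s hs => (hbd s hs).2
  -- Since `h_x = ℓ + h_y J`, the linear part of `h/ε` is `ℓ ξ + h_y(η + Jξ) + k`, and the bound on
  -- `Z` controls the middle term independently of `ρt`.
  have hhS : ∀ s ∈ Icc 0 T, |ε⁻¹ * S.h (x s, y s, ε) - ℓ (ξ s)| ≤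
      ‖S.hy p₀‖ * (KZ + ‖A.inverse q‖) + |k| + 1 := by
    intro s hs
    have h1 := hεh _ (hw s (hbdR s hs))
    rw [← hpt, fderiv_apply_eq_partial hdh, one_smul, Real.norm_eq_abs, smul_eq_mul] at h1
    change |ε⁻¹ * S.h (x s, y s, ε) - (S.hx p₀ (ξ s) + S.hy p₀ (η s) + k)| ≤ 1 at h1
    have h2 : |S.hy p₀ (η s + J (ξ s))| ≤ ‖S.hy p₀‖ * (KZ + ‖A.inverse q‖) := by
      refine ((S.hy p₀).le_opNorm _).trans ?_
      gcongr
      have := norm_sub_le (η s + J (ξ s) + A.inverse q) (A.inverse q)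
      rw [add_sub_cancel_right] at this
      linarith [hZ s hs]
    have h3 : S.hx p₀ (ξ s) + S.hy p₀ (η s) = ℓ (ξ s) + S.hy p₀ (η s + J (ξ s)) := by
      rw [map_add]
      simp only [hℓ, hrdx, sub_apply, ContinuousLinearMap.comp_apply]
      ring
    rw [h3] at h1
    rw [abs_le] at h1 h2 ⊢
    have h4 := neg_abs_le k
    have h5 := le_abs_self k
    constructor <;> linarith
  -- Attraction in the reduced system: outside the strip `|ℓ ξ| ≤ Ku` the sign of `h` selects the
  -- field that pushes back. Nothing is asked of velocities inside the strip, so sliding is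
  -- harmless.
  have hu := abs_le_of_barrier (K := Ku) hε0 ℓ hξac (by
      have h1 : |ℓ (ξ 0)| ≤ ‖ℓ‖ * ρx := (ℓ.le_opNorm _).trans (by gcongr)
      have : 0 ≤ ‖S.hy p₀‖ * (KZ + ‖A.inverse q‖) + |k| + 1 := by positivity
      linarith) (by
    filter_upwards [hxy.slow] with s hs hsT
    obtain ⟨v, ⟨hvp, hvm, -⟩, hvd⟩ := hs hsT
    have h1 := abs_le.mp (hhS s hsT)
    have hpos' : 0 ≤ ‖ℓ‖ * ρx := by positivity
    have hrest : 0 ≤ ‖S.hy p₀‖ * (KZ + ‖A.inverse q‖) + |k| + 1 := by positivity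
    refine ⟨v, hξd hvd, fun hlt => ?_, fun hlt => ?_⟩
    · have h2 : 0 < ε⁻¹ * S.h (x s, y s, ε) := by linarith
      rw [hvp (pos_of_mul_pos_right h2 hε'.le)]
      have h3 : ℓ (S.fPlus (x s, y s, ε) - S.fPlus p₀) ≤ ‖ℓ‖ * c₁ :=
        (le_abs_self _).trans ((ℓ.le_opNorm _).trans (by gcongr; exact hfpS s (hbdR s hsT)))
      rw [map_sub] at h3
      linarith
    · have h2 : ε⁻¹ * S.h (x s, y s, ε) < 0 := by linarith
      rw [hvm (by by_contra! hcon; exact absurd h2 (not_lt.mpr (by positivity)))]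
      have h3 : -(‖ℓ‖ * c₁) ≤ ℓ (S.fMinus (x s, y s, ε) - S.fMinus p₀) :=
        (neg_le_neg ((ℓ.le_opNorm _).trans (by gcongr; exact hfmS s (hbdR s hsT)))).trans
          (neg_abs_le _)
      rw [map_sub] at h3
      linarith)
  intro s hs
  have hT0 : 0 ≤ T := hs.1.trans hs.2
  have hsρt : ε⁻¹ * s ≤ ρt := by
    rw [inv_mul_le_iff₀ hε0]
    exact hs.2.trans hT
  have hRs := max_le_iff.mp (hbdR s hs)
  have hxs : x s - x₀ = ε • ξ s := by rw [hxξ s, add_sub_cancel_left]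
  have hys : y s - y₀ = ε • η s := by rw [hyη s, add_sub_cancel_left]
  -- The projected velocity is within `‖Q‖c₁` of `f_{rd,s}`, whatever convex combination is chosen.
  have hproj : ‖Q (ξ s) - Q (ξ 0) - (ε⁻¹ * s) • S.fRdS p₀‖ ≤ 1 := by
    have hsub : uIcc 0 s ⊆ uIcc 0 T := by
      rw [uIcc_of_le hs.1, uIcc_of_le hT0]
      exact Icc_subset_Icc_right hs.2
    have hac : AbsolutelyContinuousOnInterval
        (fun t => Q (ξ t) - (ε⁻¹ * t) • S.fRdS p₀) 0 s :=
      ((hξac.mono hsub).comp_contDiff Q.contDiff).fun_sub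
        (ContDiff.contDiffOn (by fun_prop)).absolutelyContinuousOnInterval
    have h1 := hac.norm_sub_le_of_ae_hasDerivAt (C := ε⁻¹ * (‖Q‖ * c₁)) hs.1 (by
      filter_upwards [hxy.slow] with t ht hts
      have htT : t ∈ Icc 0 T := ⟨hts.1, hts.2.trans hs.2⟩
      obtain ⟨v, ⟨-, -, hv⟩, hvd⟩ := ht htT
      refine ⟨ε⁻¹ • (Q v - S.fRdS p₀), ?_, ?_⟩
      · rw [norm_smul, Real.norm_of_nonneg hε'.le]
        gcongr
        exact norm_slidingProj_sub_le hΔ.ne' (hfmS t (hbdR t htT)) (hfpS t (hbdR t htT)) hv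
      · have h2 := Q.hasFDerivAt.comp_hasDerivAt t (hξd hvd)
        have h3 : HasDerivAt (fun t : ℝ => (ε⁻¹ * t) • S.fRdS p₀) (ε⁻¹ • S.fRdS p₀) t := by
          simpa using ((hasDerivAt_id t).const_mul ε⁻¹).smul_const (S.fRdS p₀)
        exact (h2.sub h3).congr_deriv (by rw [map_smul, smul_sub]))
    have h2 : Q (ξ s) - Q (ξ 0) - (ε⁻¹ * s) • S.fRdS p₀ =
        (Q (ξ s) - (ε⁻¹ * s) • S.fRdS p₀) - (Q (ξ 0) - (ε⁻¹ * 0) • S.fRdS p₀) := by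
      simp only [mul_zero, zero_smul]
      abel
    rw [h2]
    refine h1.trans ?_
    calc ε⁻¹ * (‖Q‖ * c₁) * (s - 0) = ‖Q‖ * c₁ * (ε⁻¹ * s) := by ring
      _ ≤ ‖Q‖ * c₁ * ρt := by gcongr
      _ ≤ 1 := hc₁Q
  have hξbound : ‖ξ s - ξ 0 - (ε⁻¹ * s) • S.fRdS p₀‖ ≤ Bx := by
    -- The splitting `u = Q u + (ℓ u / ℓ d) d`: the first part is the projected drift, the second is
    -- bounded by the barrier.
    have h1 : ξ s - ξ 0 - (ε⁻¹ * s) • S.fRdS p₀ =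
        (Q (ξ s) - Q (ξ 0) - (ε⁻¹ * s) • S.fRdS p₀) +
          ((ℓ d)⁻¹ * (ℓ (ξ s) - ℓ (ξ 0))) • d := by
      rw [hQ, slidingProj_apply, slidingProj_apply, mul_sub, sub_smul]
      abel
    rw [h1]
    refine (norm_add_le _ _).trans (add_le_add hproj ?_)
    rw [norm_smul, norm_mul, Real.norm_of_nonneg (inv_pos.mpr hΔ).le]
    gcongr
    refine (norm_sub_le _ _).trans ?_
    rw [Real.norm_eq_abs, Real.norm_eq_abs]
    linarith [hu s hs, hu 0 ⟨le_rfl, hT0⟩]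
  have hηbound : ‖η s - η 0 + (ε⁻¹ * s) • J (S.fRdS p₀)‖ ≤ 2 * KZ + ‖J‖ * Bx := by
    -- Writing `η = Z - Jξ - A⁻¹q` passes the estimate for `ξ` on to `η`.
    have h1 : η s - η 0 + (ε⁻¹ * s) • J (S.fRdS p₀) =
        ((η s + J (ξ s) + A.inverse q) - (η 0 + J (ξ 0) + A.inverse q)) -
          J (ξ s - ξ 0 - (ε⁻¹ * s) • S.fRdS p₀) := by
      rw [map_sub, map_sub, map_smul]
      abel
    rw [h1]
    have h2 := norm_sub_le ((η s + J (ξ s) + A.inverse q) - (η 0 + J (ξ 0) + A.inverse q))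
      (J (ξ s - ξ 0 - (ε⁻¹ * s) • S.fRdS p₀))
    have h3 := norm_sub_le (η s + J (ξ s) + A.inverse q) (η 0 + J (ξ 0) + A.inverse q)
    have h4 : ‖J (ξ s - ξ 0 - (ε⁻¹ * s) • S.fRdS p₀)‖ ≤ ‖J‖ * Bx :=
      (J.le_opNorm _).trans (by gcongr)
    linarith [hZ s hs, hZ 0 ⟨le_rfl, hT0⟩]
  have hscale : ∀ {V : Type} [NormedAddCommGroup V] [NormedSpace ℝ V] {v : V} {B : ℝ},
      ‖v‖ ≤ B → ‖ε • v‖ ≤ ε * B := fun h => by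
    rw [norm_smul, Real.norm_of_nonneg hε0.le]
    gcongr
  refine ⟨hxs ▸ hscale hRs.1, hys ▸ hscale hRs.2, ?_, ?_⟩
  · have h1 : x s - x 0 - s • S.fRdS p₀ = ε • (ξ s - ξ 0 - (ε⁻¹ * s) • S.fRdS p₀) := by
      rw [hxξ s, hxξ 0, smul_sub, smul_sub, smul_smul, mul_inv_cancel_left₀ hε0.ne']
      abel
    rw [h1]
    exact hscale (hξbound.trans (by have : 0 ≤ 2 * KZ + ‖J‖ * Bx := by positivity
                                    linarith))
  · have h1 : y s - y 0 + s • J (S.fRdS p₀) = ε • (η s - η 0 + (ε⁻¹ * s) • J (S.fRdS p₀)) := by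
      rw [hyη s, hyη 0, smul_add, smul_sub, smul_smul, mul_inv_cancel_left₀ hε0.ne']
      abel
    rw [h1]
    exact hscale (hηbound.trans (by linarith))

end SlowFastSystem

/-! ### Local existence for the full slow-fast system -/

namespace SlowFastSystem

variable {n m : ℕ} (S : SlowFastSystem n m)

/-- The full vector field for a given choice `f` of the slow vector field. -/
noncomputable def fullField
    (f : EuclideanSpace ℝ (Fin n) × EuclideanSpace ℝ (Fin m) × ℝ → EuclideanSpace ℝ (Fin n))
    (ε : ℝ) (z : EuclideanSpace ℝ (Fin n) × EuclideanSpace ℝ (Fin m)) :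
    EuclideanSpace ℝ (Fin n) × EuclideanSpace ℝ (Fin m) :=
  (f (z.1, z.2, ε), ε⁻¹ • S.g (z.1, z.2, ε))

variable {S}

/-- Switched curves of the full vector fields are Filippov trajectories. -/
theorem isTrajectory_of_isSwitchedCurve {ε T : ℝ} (hT : 0 ≤ T) {C : NNReal}
    {φ : ℝ → EuclideanSpace ℝ (Fin n) × EuclideanSpace ℝ (Fin m)}
    (hφ : IsSwitchedCurve (S.fullField S.fPlus ε) (S.fullField S.fMinus ε)
      (fun z => S.h (z.1, z.2, ε)) C T φ) :
    S.IsTrajectory ε T (fun s => (φ s).1) (fun s => (φ s).2) := by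
  have hac : AbsolutelyContinuousOnInterval φ 0 T :=
    LipschitzOnWith.absolutelyContinuousOnInterval (K := C)
      (by rw [uIcc_of_le hT]; exact hφ.lipschitz)
  have hfst : ∀ {s v}, HasDerivAt φ v s → HasDerivAt (fun s => (φ s).1) v.1 s := fun {s _} hd =>
    (hasFDerivAt_fst (𝕜 := ℝ) (p := φ s)).comp_hasDerivAt s hd
  refine ⟨hac.comp_contDiff contDiff_fst, hac.comp_contDiff contDiff_snd, ?_, ?_⟩
  · filter_upwards [hφ.ae_deriv] with s hs hsT
    rcases hs hsT with ⟨hH, hd⟩ | ⟨hH, hd⟩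
    · exact ⟨_, ⟨fun _ => rfl, fun h => absurd h hH.not_gt, right_mem_segment ℝ _ _⟩,
        hfst hd⟩
    · exact ⟨_, ⟨fun h => absurd h hH.not_gt, fun _ => rfl, left_mem_segment ℝ _ _⟩,
        hfst hd⟩
  · filter_upwards [hφ.ae_deriv] with s hs hsT
    rcases hs hsT with ⟨-, hd⟩ | ⟨-, hd⟩
    · exact hasFDerivAt_snd.comp_hasDerivAt s hd
    · exact hasFDerivAt_snd.comp_hasDerivAt s hd

/-- Switched curves have no sliding segment. -/
theorem nonSliding_of_isSwitchedCurve {ε T : ℝ} {C : NNReal}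
    {φ : ℝ → EuclideanSpace ℝ (Fin n) × EuclideanSpace ℝ (Fin m)}
    (hφ : IsSwitchedCurve (S.fullField S.fPlus ε) (S.fullField S.fMinus ε)
      (fun z => S.h (z.1, z.2, ε)) C T φ) :
    S.NonSliding ε T (fun s => (φ s).1) (fun s => (φ s).2) := by
  intro a b ha hab hbT
  by_contra! hcon
  have hnull : ∀ᵐ s : ℝ, s ∉ Icc a b := by
    filter_upwards [hφ.ae_deriv] with s hs hsab
    rcases hs ⟨ha.trans hsab.1, hsab.2.trans hbT⟩ with ⟨hH, -⟩ | ⟨hH, -⟩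
    · exact hH.ne' (hcon s hsab)
    · exact hH.ne (hcon s hsab)
  have := measure_eq_zero_iff_ae_notMem.mpr hnull
  rw [Real.volume_Icc, ENNReal.ofReal_eq_zero] at this
  linarith

/-- Near a point where the normal velocities `T₋ < T₊` of the switching manifold are repelling,
the two full vector fields admit switched curves for a uniform time. -/
theorem exists_switchedCurve_near {x₀ : EuclideanSpace ℝ (Fin n)}
    {y₀ : EuclideanSpace ℝ (Fin m)} (hsmooth : S.SmoothNear (x₀, y₀, 0))
    (hT : S.TMinus (x₀, y₀, 0) < S.TPlus (x₀, y₀, 0)) :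
    ∃ r > 0, ∀ ε, 0 < ε → ε < r → ∃ C : NNReal, ∃ τ > 0, ∀ z ∈ closedBall (x₀, y₀) r,
      ∃ φ, φ 0 = z ∧ IsSwitchedCurve (S.fullField S.fPlus ε) (S.fullField S.fMinus ε)
        (fun z => S.h (z.1, z.2, ε)) C τ φ := by
  obtain ⟨hsp, hsm, hsg, hsh⟩ := hsmooth
  set p₀ : EuclideanSpace ℝ (Fin n) × EuclideanSpace ℝ (Fin m) × ℝ := (x₀, y₀, 0) with hp₀
  -- The difference of the normal velocities of the two full fields. Their common component `g/ε`
  -- cancels, so the gap has a lower bound uniform in small `ε`.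
  let gap : EuclideanSpace ℝ (Fin n) × EuclideanSpace ℝ (Fin m) × ℝ → ℝ :=
    fun p => fderiv ℝ S.h p (S.fPlus p - S.fMinus p, 0, 0)
  set δ := (S.TPlus p₀ - S.TMinus p₀) / 4 with hδ
  have hδ0 : 0 < δ := by rw [hδ]; linarith
  have hgap0 : gap p₀ = 4 * δ := by
    simp only [gap]
    rw [fderiv_apply_eq_partial (hsh.differentiableAt one_ne_zero), map_zero, zero_smul, add_zero,
      add_zero, map_sub, hδ, TPlus, TMinus, hx]
    ring
  have hgapc : ContinuousAt gap p₀ :=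
    (hsh.continuousAt_fderiv one_ne_zero).clm_apply
      ((hsp.continuousAt.sub hsm.continuousAt).prodMk continuousAt_const)
  have hev : ∀ᶠ p in 𝓝 p₀, (ContDiffAt ℝ 1 S.fPlus p ∧ ContDiffAt ℝ 1 S.fMinus p ∧
      ContDiffAt ℝ 1 S.g p ∧ ContDiffAt ℝ 1 S.h p) ∧ 2 * δ < gap p :=
    ((hsp.eventually (by simp)).and ((hsm.eventually (by simp)).and
      ((hsg.eventually (by simp)).and (hsh.eventually (by simp))))).and
      (hgapc.eventually (lt_mem_nhds (by rw [hgap0]; linarith)))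
  obtain ⟨ρ, hρ, hball⟩ := Metric.eventually_nhds_iff_ball.mp hev
  -- Starting points range over radius `ρ/4` and curves over `ρ/2`. The speed bound and step time
  -- may depend on `ε`, because the fast field carries `1/ε`; only uniformity in position matters.
  refine ⟨ρ / 4, by positivity, fun ε hε hερ => ?_⟩
  let ι : EuclideanSpace ℝ (Fin n) × EuclideanSpace ℝ (Fin m) →
      EuclideanSpace ℝ (Fin n) × EuclideanSpace ℝ (Fin m) × ℝ := fun z => (z.1, z.2, ε)
  have hι : ContDiff ℝ 1 ι := by fun_prop
  have hιmem : ∀ z ∈ closedBall (x₀, y₀) (ρ / 2), ι z ∈ Metric.ball p₀ ρ := by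
    intro z hz
    rw [mem_closedBall, Prod.dist_eq, max_le_iff] at hz
    rw [Metric.mem_ball, Prod.dist_eq, Prod.dist_eq]
    refine max_lt (by simp only [ι, hp₀]; linarith [hz.1]) (max_lt ?_ ?_)
    · simp only [ι, hp₀]; linarith [hz.2]
    · simp only [ι, hp₀, Real.dist_0_eq_abs, abs_of_pos hε]
      linarith
  have hreg := fun z hz => hball (ι z) (hιmem z hz)
  have hfield : ∀ f : EuclideanSpace ℝ (Fin n) × EuclideanSpace ℝ (Fin m) × ℝ →
      EuclideanSpace ℝ (Fin n), (∀ z ∈ closedBall (x₀, y₀) (ρ / 2), ContDiffAt ℝ 1 f (ι z)) →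
      ContDiffOn ℝ 1 (S.fullField f ε) (closedBall (x₀, y₀) (ρ / 2)) := fun f hf z hz =>
    (((hf z hz).comp z hι.contDiffAt).prodMk
      (((hreg z hz).1.2.2.1.comp z hι.contDiffAt).const_smul ε⁻¹)).contDiffWithinAt
  have hFp := hfield S.fPlus fun z hz => (hreg z hz).1.1
  have hFm := hfield S.fMinus fun z hz => (hreg z hz).1.2.1
  have hcpt := isCompact_closedBall (x₀, y₀) (ρ / 2)
  obtain ⟨Kp, hKp⟩ := hFp.exists_lipschitzOnWith one_ne_zero (convex_closedBall _ _) hcpt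
  obtain ⟨Km, hKm⟩ := hFm.exists_lipschitzOnWith one_ne_zero (convex_closedBall _ _) hcpt
  obtain ⟨Cp, hCp⟩ := hcpt.exists_bound_of_continuousOn hFp.continuousOn
  obtain ⟨Cm, hCm⟩ := hcpt.exists_bound_of_continuousOn hFm.continuousOn
  let ι' : EuclideanSpace ℝ (Fin n) × EuclideanSpace ℝ (Fin m) →L[ℝ]
      EuclideanSpace ℝ (Fin n) × EuclideanSpace ℝ (Fin m) × ℝ :=
    (ContinuousLinearMap.fst ℝ _ _).prod ((ContinuousLinearMap.snd ℝ _ _).prod 0)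
  have hι' : ∀ z, HasFDerivAt ι ι' z := fun z =>
    hasFDerivAt_fst.prodMk (hasFDerivAt_snd.prodMk (hasFDerivAt_const ε z))
  let H' : EuclideanSpace ℝ (Fin n) × EuclideanSpace ℝ (Fin m) →
      EuclideanSpace ℝ (Fin n) × EuclideanSpace ℝ (Fin m) →L[ℝ] ℝ :=
    fun z => (fderiv ℝ S.h (ι z)).comp ι'
  have hH : ∀ z ∈ closedBall (x₀, y₀) (ρ / 2), HasFDerivAt (fun z => S.h (z.1, z.2, ε)) (H' z) z :=
    fun z hz => ((hreg z hz).1.2.2.2.differentiableAt one_ne_zero).hasFDerivAt.comp z (hι' z)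
  have hH'c : ContinuousOn H' (closedBall (x₀, y₀) (ρ / 2)) := fun z hz =>
    ((((hreg z hz).1.2.2.2.continuousAt_fderiv one_ne_zero).comp
      hι.continuous.continuousAt).clm_comp continuousAt_const).continuousWithinAt
  have hunif : ∀ F : EuclideanSpace ℝ (Fin n) × EuclideanSpace ℝ (Fin m) →
      EuclideanSpace ℝ (Fin n) × EuclideanSpace ℝ (Fin m),
      ContDiffOn ℝ 1 F (closedBall (x₀, y₀) (ρ / 2)) →
      UniformContinuousOn (fun z => H' z (F z)) (closedBall (x₀, y₀) (ρ / 2)) := fun F hF =>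
    hcpt.uniformContinuousOn_of_continuous (hH'c.clm_apply hF.continuousOn)
  refine ⟨(max Cp Cm).toNNReal, exists_switchedCurve_local (a := ρ / 2) (by positivity)
    (by linarith) (hKp.weaken (le_max_left Kp Km)) (hKm.weaken (le_max_right Kp Km))
    (fun z hz => ((hCp z hz).trans (le_max_left _ _)).trans (Real.le_coe_toNNReal _))
    (fun z hz => ((hCm z hz).trans (le_max_right _ _)).trans (Real.le_coe_toNNReal _))
    hH (hunif _ hFp) (hunif _ hFm) hδ0 fun z hz => ?_⟩
  have hgz := (hreg z hz).2
  have : H' z (S.fullField S.fPlus ε z) - H' z (S.fullField S.fMinus ε z) = gap (ι z) := by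
    rw [← map_sub]
    simp [H', ι', ι, gap, fullField]
  rw [this]
  exact hgz.le

end SlowFastSystem

/-! ### Existence up to the final time and the expansion -/

theorem theorem1 {n m : ℕ} (S : SlowFastSystem n m)
    (yc : EuclideanSpace ℝ (Fin n) → EuclideanSpace ℝ (Fin m))
    (x₀ : EuclideanSpace ℝ (Fin n))
    (hsmooth : S.SmoothNear (x₀, yc x₀, 0))
    (heq : S.FastEquilibriumNear yc x₀)
    (hstab : S.TransversallyStableNear yc x₀)
    (hslide : S.AttractingReducedSlidingNear yc x₀)
    (htrans : S.TransversalNear yc x₀)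
    (hord₁ : S.SMinus (x₀, yc x₀, 0) < S.TMinus (x₀, yc x₀, 0))
    (hord₂ : S.TMinus (x₀, yc x₀, 0) < S.TPlus (x₀, yc x₀, 0))
    (hord₃ : S.TPlus (x₀, yc x₀, 0) < S.SPlus (x₀, yc x₀, 0)) :
    ∀ ρx > (0 : ℝ), ∀ ρy > (0 : ℝ), ∃ ρf > (0 : ℝ), ∀ ρt > (0 : ℝ), ∃ εmax > (0 : ℝ),
      ∀ (δx : EuclideanSpace ℝ (Fin n)) (δy : EuclideanSpace ℝ (Fin m)) (ε : ℝ),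
        ‖δx‖ ≤ ρx → ‖δy‖ ≤ ρy → 0 < ε → ε < εmax →
        (∃ x y, S.IsNonSlidingTrajectoryFrom ε (ε * ρt) (x₀ + ε • δx) (yc x₀ + ε • δy) x y) ∧
        ∀ x y, S.IsNonSlidingTrajectoryFrom ε (ε * ρt) (x₀ + ε • δx) (yc x₀ + ε • δy) x y →
          ∃ r : ℝ → EuclideanSpace ℝ (Fin n) × EuclideanSpace ℝ (Fin m),
            Continuous r ∧ (∀ t, ‖r t‖ ≤ ρf) ∧
            ∀ t ∈ Icc 0 ρt,
              (x (ε * t) - x 0, y (ε * t) - y 0) =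
                (ε * t) • (S.fRdS (x₀, yc x₀, 0),
                  -(S.gyInvGx (x₀, yc x₀, 0) (S.fRdS (x₀, yc x₀, 0)))) + ε • r t := by
  intro ρx hρx ρy hρy
  have hg0 : S.g (x₀, yc x₀, 0) = 0 := heq.self_of_nhds
  have hh0 : S.h (x₀, yc x₀, 0) = 0 := htrans.1
  obtain ⟨c, hc, hspec⟩ := hstab
  obtain ⟨hfp, hfm⟩ := hslide.self_of_nhds hh0
  obtain ⟨ρf, hρf, hbounds⟩ := SlowFastSystem.eventually_trajectory_bounds hsmooth hg0 hh0 hc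
    hspec.self_of_nhds hfp hfm hρx hρy
  obtain ⟨r, hr, hlocal⟩ := SlowFastSystem.exists_switchedCurve_near hsmooth hord₂
  refine ⟨ρf, hρf, fun ρt hρt => ?_⟩
  obtain ⟨R, hR, hev⟩ := hbounds ρt hρt
  obtain ⟨ε₁, hε₁, hsub⟩ := mem_nhdsGT_iff_exists_Ioo_subset.mp hev
  have hε₁ : 0 < ε₁ := hε₁
  -- The three constraints give the trajectory bounds, local existence, and the inclusion of the
  -- `εR`-ball in the `r`-ball where local existence holds.
  refine ⟨min ε₁ (min r (r / R)), by positivity, fun δx δy ε hδx hδy hε hεlt => ?_⟩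
  have hεb := hsub ⟨hε, hεlt.trans_le (min_le_left _ _)⟩
  have hεr : ε < r := hεlt.trans_le ((min_le_right _ _).trans (min_le_left _ _))
  have hεR : ε * R ≤ r := by
    have := hεlt.trans_le ((min_le_right _ _).trans (min_le_right _ _))
    exact ((lt_div_iff₀ hR).mp this).le
  have hini : ∀ {k : ℕ} {u v : EuclideanSpace ℝ (Fin k)} {ρ : ℝ}, ‖v‖ ≤ ρ →
      ‖u + ε • v - u‖ ≤ ε * ρ := fun h => by
    rw [add_sub_cancel_left, norm_smul, Real.norm_of_nonneg hε.le]
    gcongr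
  have hT0 : 0 ≤ ε * ρt := by positivity
  constructor
  · obtain ⟨C, τ, hτ, hloc⟩ := hlocal ε hε hεr
    obtain ⟨φ, hφ0, hφ⟩ := exists_switchedCurve_of_apriori hτ hT0 hloc
      (p := (x₀ + ε • δx, yc x₀ + ε • δy)) (by
        intro σ hσ φ hφ0 hφ
        have htraj := SlowFastSystem.isTrajectory_of_isSwitchedCurve hσ.1 hφ
        -- The trajectory bounds hold on every shorter interval, hence for the partial curve on `[0,
        -- σ]`.
        obtain ⟨h1, h2, -, -⟩ := hεb σ hσ.2 _ _ htraj (by simpa only [hφ0] using hini hδx)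
          (by simpa only [hφ0] using hini hδy) σ ⟨hσ.1, le_rfl⟩
        rw [mem_closedBall, Prod.dist_eq, dist_eq_norm, dist_eq_norm]
        exact max_le (h1.trans hεR) (h2.trans hεR))
    exact ⟨_, _, SlowFastSystem.isTrajectory_of_isSwitchedCurve hT0 hφ,
      SlowFastSystem.nonSliding_of_isSwitchedCurve hφ, by rw [hφ0], by rw [hφ0]⟩
  · rintro x y ⟨htraj, -, hx0, hy0⟩
    have hb := hεb _ le_rfl x y htraj (by rw [hx0]; exact hini hδx) (by rw [hy0]; exact hini hδy)
    set v := S.fRdS (x₀, yc x₀, 0) with hv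
    set w := S.gyInvGx (x₀, yc x₀, 0) v with hw
    let r₀ : ℝ → EuclideanSpace ℝ (Fin n) × EuclideanSpace ℝ (Fin m) := fun t =>
      ε⁻¹ • (x (ε * t) - x 0 - (ε * t) • v, y (ε * t) - y 0 + (ε * t) • w)
    have hmaps : ∀ t ∈ Icc 0 ρt, ε * t ∈ Icc 0 (ε * ρt) := fun t ht =>
      ⟨mul_nonneg hε.le ht.1, mul_le_mul_of_nonneg_left ht.2 hε.le⟩
    have hxc : ContinuousOn (fun t => x (ε * t)) (Icc 0 ρt) :=
      ((uIcc_of_le hT0 ▸ htraj.absCont_x.continuousOn :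
        ContinuousOn x (Icc 0 (ε * ρt)))).comp (by fun_prop) hmaps
    have hyc : ContinuousOn (fun t => y (ε * t)) (Icc 0 ρt) :=
      ((uIcc_of_le hT0 ▸ htraj.absCont_y.continuousOn :
        ContinuousOn y (Icc 0 (ε * ρt)))).comp (by fun_prop) hmaps
    have hr₀ : ContinuousOn r₀ (Icc 0 ρt) :=
      (((hxc.sub continuousOn_const).sub (by fun_prop)).prodMk
        ((hyc.sub continuousOn_const).add (by fun_prop))).const_smul ε⁻¹
    -- The remainder is determined on `[0, ρt]` and extended by its endpoint values, which keeps it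
    -- continuous and equally bounded on the whole line.
    refine ⟨IccExtend hρt.le ((Icc 0 ρt).domRestrict r₀), ?_, fun t => ?_, fun t ht => ?_⟩
    · exact (continuousOn_iff_continuous_domRestrict.mp hr₀).Icc_extend'
    · obtain ⟨-, -, h1, h2⟩ := hb _ (hmaps _ (projIcc 0 ρt hρt.le t).2)
      rw [IccExtend, Function.comp_apply, domRestrict_apply]
      simp only [r₀]
      rw [norm_smul, Real.norm_of_nonneg (inv_pos.mpr hε).le, inv_mul_le_iff₀ hε, Prod.norm_def]
      exact max_le h1 h2
    · rw [IccExtend_of_mem _ _ ht, domRestrict_apply]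
      simp only [r₀]
      rw [smul_inv_smul₀ hε.ne', Prod.smul_mk, Prod.mk_add_mk, smul_neg]
      congr 1 <;> abel
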